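/- **Setting.** Let $\mathbb T$ be a set of finite times with a decidable strict total order $<$, let $\mathcal L$ be a countably infinite set of channel names, and fix a countably infinite set of variables. A *payload* is a selector $\pi_1$ or $\pi_2$, the closing signal $()$, or a channel name; an *action* $\alpha$ is the silent action $\varepsilon$, or $a!c$, or $a?c$ with $a\in\mathcal L$ and $c$ a payload. An *atomic process* over a set $X$ is $\mathrm{proc}_a P$ ($a\in\mathcal L$, $P\in X$) or a forwarder $\mathrm{fwd}_{a\,b}$ ($a,b\in\mathcal L$; it provides $a$ and forwards to $b$). A *process language* $S$ is a set of nameless objects together with a relation $(P,a)\xrightarrow{\alpha}_T\Omega$ between an object $P$ named $a$, an action, a time $T\in\mathbb T$ and a finite multiset $\Omega$ of atomic processes over $S$. Let $\mathrm{NObj}$ be the disjoint union of the object sets of all process languages; a *configuration* is a finite multiset of atomic processes over $\mathrm{NObj}$, and a *nameless configuration* is a pair $(\Omega,P)$ of a configuration and $P\in\mathrm{NObj}$, with $(\Omega,P)[a]=\Omega\uplus\{\mathrm{proc}_aP\}$ and $(\Omega,P)\uplus\Omega_0=(\Omega\uplus\Omega_0,P)$. Transitions $\Omega\xrightarrow{\alpha}_T\Omega'$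 of configurations are generated by: the transitions of the languages; framing ($\Omega\uplus\Omega_0\xrightarrow{\alpha}_T\Omega'\uplus\Omega_0$ if $\Omega\xrightarrow{\alpha}_T\Omega'$); $\{\mathrm{proc}_aP,\mathrm{fwd}_{b\,a}\}\xrightarrow{\varepsilon}_T\{\mathrm{proc}_bP\}$; and $\Omega_1\uplus\Omega_2\xrightarrow{\varepsilon}_T\Omega_1'\uplus\Omega_2'$ if $\Omega_1\xrightarrow{a!c}_T\Omega_1'$ and $\Omega_2\xrightarrow{a?c}_T\Omega_2'$. **Computable trajectories.** Multisteppings $\sigma:(\Omega,T)\Rightarrow(\Omega',T')$ are generated by $\mathsf{refl}:(\Omega,T)\Rightarrow(\Omega,T)$; $\mathsf{stepT}(\sigma):(\Omega,T_1)\Rightarrow(\Omega',T_3)$ for $T_1\le T_2$ and $\sigma:(\Omega,T_2)\Rightarrow(\Omega',T_3)$; and $\mathsf{stepC}(\sigma):(\Omega,T_1)\Rightarrow(\Omega'',T_2)$ for $\Omega\xrightarrow{\varepsilon}_{T_1}\Omega'$ and $\sigma:(\Omega',T_1)\Rightarrow(\Omega'',T_2)$. A multistepping *realizes* a function $s$ on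 $[T,\infty)$ to configurations by the rules: $\mathsf{refl}$ realizes the constant function $\Omega$; if $\sigma$ realizes $s$, then $\mathsf{stepT}(\sigma)$ realizes the extension of $s$ by the constant value $\Omega$ on $[T_1,T_2)$; if $\sigma$ realizes $s$, then $\mathsf{stepC}(\sigma)$ realizes $s$. A *computable trajectory* $w:\mathcal S[T,\infty)$ consists of nameless configurations $\mathrm{start}(w)$, $\mathrm{end}(w)$, a function $t\mapsto w[t]$ from $[T,\infty)$ to nameless configurations and, for each $a\in\mathcal L$, a finite time $T_a$ and a multistepping $(\mathrm{start}(w)[a],T)\Rightarrow(\mathrm{end}(w)[a],T_a)$ that realizes $t\mapsto w[t][a]$. **Types and the logical relation.** Types are $A::=1^{t.p}\mid A_1\multimap^{t.p}A_2\mid A_1\otimes^{t.p}A_2\mid A_1\,\&^{t.p}A_2\mid A_1\oplus^{t.p}A_2$, where the time variable $t$ is bound in the proposition $p$ and in $A_1,A_2$; propositions are arbitrary predicates of the time variables in scope. Write $\mathrm{prop}(A,T)$ for $p[T/t]$. For a mode $d\in\{\text{provider},\text{client}\}$ with opposite $d^{-1}$ and $w:\mathcal S[T,\infty)$, the term interpretation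 is - $w\in\mathcal E[\![A]\!]_T^{\text{client}}$ iff for all $T'$: $\mathrm{prop}(A,T')$ and $T\le T'$ imply $w[T']\in\mathcal V[\![A]\!]_{T'}^{\text{client}}$; - $w\in\mathcal E[\![A]\!]_T^{\text{provider}}$ iff for all $T'$: $\mathrm{prop}(A,T')$ implies $T\le T'$ and $w[T']\in\mathcal V[\![A]\!]_{T'}^{\text{provider}}$. The value interpretation of a nameless configuration $\Omega$ is as follows, where $A_i$ stands for $A_i[T/t]$ and all $w_i:\mathcal S[T,\infty)$: - $\Omega\in\mathcal V[\![1^{t.p}]\!]_T^d$ iff $\forall a,\ \Omega[a]\xrightarrow{a!()}_T\varnothing$; - $\Omega\in\mathcal V[\![A_1\otimes^{t.p}A_2]\!]_T^d$ iff $\forall a\,\exists c\,\exists w_1\in\mathcal E[\![A_1]\!]_T^d\,\exists w_2\in\mathcal E[\![A_2]\!]_T^d$, $\Omega[a]\xrightarrow{a!c}_T\mathrm{start}(w_1)[c]\uplus\mathrm{start}(w_2)[a]$; - $\Omega\in\mathcal V[\![A_1\multimap^{t.p}A_2]\!]_T^d$ iff $\forall a\,\forall w_1\in\mathcal E[\![A_1]\!]_T^{d^{-1}}\,\forall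 c\,\exists\Omega_2\,\exists w_2\in\mathcal E[\![A_2]\!]_T^d$, $\Omega[a]\xrightarrow{a?c}_T\Omega_2[a]$ and $\mathrm{start}(w_2)=\Omega_2\uplus\mathrm{start}(w_1)[c]$; - $\Omega\in\mathcal V[\![A_1\,\&^{t.p}A_2]\!]_T^d$ iff $\forall i\in\{1,2\}\,\forall a\,\exists w_i\in\mathcal E[\![A_i]\!]_T^d$, $\Omega[a]\xrightarrow{a?\pi_i}_T\mathrm{start}(w_i)[a]$; - $\Omega\in\mathcal V[\![A_1\oplus^{t.p}A_2]\!]_T^d$ iff $\exists i\in\{1,2\}\,\forall a\,\exists w_i\in\mathcal E[\![A_i]\!]_T^d$, $\Omega[a]\xrightarrow{a!\pi_i}_T\mathrm{start}(w_i)[a]$. **Terms.** With $s$ a channel name or a variable, $$\begin{aligned}M::={}&\mathsf{fwd}^T(s)\mid\mathsf{let}^T\,x{:}A\leftarrow M_1;M_2\mid\mathsf{send}^{t.p}()\mid\mathsf{recv}^T_s();M\mid\mathsf{recv}^{t.p}(x\Rightarrow M)\mid\mathsf{send}^T_s(M_1);M_2\\\mid{}&\mathsf{send}^{t.p}(M_1);M_2\mid\mathsf{recv}^T_s(x\Rightarrow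 M)\mid\mathsf{recv}^{t.p}(\pi_1\Rightarrow M_1\mid\pi_2\Rightarrow M_2)\mid\mathsf{send}^T_s(\pi_i);M\mid\mathsf{send}^{t.p}(\pi_i);M\mid\mathsf{recv}^T_s(\pi_1\Rightarrow M_1\mid\pi_2\Rightarrow M_2).\end{aligned}$$ The $x$ of $\mathsf{let}$ is bound in $M_2$, an $x\Rightarrow M$ binds $x$ in $M$, and $t.p$ also binds $t$ in the subterms. For a finite partial map $\sigma$ from variables to channel names, $\hat\sigma(M)$ replaces the free variables in the domain of $\sigma$ by their names (removing $x$ from $\sigma$ below a binder of $x$, and below $\mathsf{recv}^T_x();-$). The terms form a process language with the transitions (for all $a,b,c\in\mathcal L$, $i\in\{1,2\}$) - $(\mathsf{fwd}^T(b),a)\xrightarrow{\varepsilon}_T\{\mathrm{fwd}_{a\,b}\}$; $\ (\mathsf{let}^T x{:}A\leftarrow M_1;M_2,a)\xrightarrow{\varepsilon}_T\{\mathrm{proc}_bM_1,\mathrm{proc}_a\widehat{b/x}(M_2)\}$; - $(\mathsf{recv}^T_b();M,a)\xrightarrow{b?()}_T\{\mathrm{proc}_aM\}$; $\ (\mathsf{recv}^T_b(x\Rightarrow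 M),a)\xrightarrow{b?c}_T\{\mathrm{proc}_a\widehat{c/x}(M)\}$; $\ (\mathsf{send}^T_b(M_1);M_2,a)\xrightarrow{b!c}_T\{\mathrm{proc}_cM_1,\mathrm{proc}_aM_2\}$; - $(\mathsf{recv}^T_b(\pi_1\Rightarrow M_1\mid\pi_2\Rightarrow M_2),a)\xrightarrow{b?\pi_i}_T\{\mathrm{proc}_aM_i\}$; $\ (\mathsf{send}^T_b(\pi_i);M,a)\xrightarrow{b!\pi_i}_T\{\mathrm{proc}_aM\}$; - for every $T$ with $p[T/t]$, and with $T$ substituted for $t$ in the subterms: $(\mathsf{send}^{t.p}(),a)\xrightarrow{a!()}_T\varnothing$; $(\mathsf{send}^{t.p}(M_1);M_2,a)\xrightarrow{a!c}_T\{\mathrm{proc}_aM_2,\mathrm{proc}_cM_1\}$; $(\mathsf{recv}^{t.p}(x\Rightarrow M),a)\xrightarrow{a?c}_T\{\mathrm{proc}_a\widehat{c/x}(M)\}$; $(\mathsf{send}^{t.p}(\pi_i);M,a)\xrightarrow{a!\pi_i}_T\{\mathrm{proc}_aM\}$; $(\mathsf{recv}^{t.p}(\pi_1\Rightarrow M_1\mid\pi_2\Rightarrow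 M_2),a)\xrightarrow{a?\pi_i}_T\{\mathrm{proc}_aM_i\}$. **Typing.** $\mathcal G$ is a finite list of time variables, $\mathcal F$ a finite list of propositions over $\mathcal G$, $\Gamma$ a finite partial map from variables to types over $\mathcal G$; $\mathcal G;\mathcal F\vdash\varphi$ means that $\varphi$ is true under every instantiation of $\mathcal G$ that makes all of $\mathcal F$ true. In $\Gamma,x{:}A$ it is understood that $x\notin\mathrm{dom}\,\Gamma$ (and that variables added together are distinct), and in $\Gamma_1,\Gamma_2$ that the domains are disjoint. Retyping. $\mathcal G;\mathcal F\vdash A\rtimes B\ @\ T$, for $A,B$ with the same outermost connective and predicates $t.p$, $t.q$, holds if $\mathcal G,t;\mathcal F,q\vdash p$ and $\mathcal G,t;\mathcal F,q\vdash T\le t$ and, under $\mathcal G,t;\mathcal F,q$ at time $t$: $A_1\rtimes B_1$ and $A_2\rtimes B_2$ for $\otimes,\&,\oplus$; $B_1\rtimes A_1$ and $A_2\rtimes B_2$ for $\multimap$; nothing for $1$. $\mathcal G;\mathcal F\vdash A\ltimes B\ @\ T$ holds if $\mathcal G,t;\mathcal F,T\le t,q\vdash p$ and, under $\mathcal G,t;\mathcal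 F,T\le t,q$ at time $t$, the same premises hold with $\ltimes$ for $\rtimes$. The judgement $\mathcal G;\mathcal F\mid\Gamma\vdash M\ @\ T::A$ is generated by the following rules. In the rules *-R* the premises are over $\mathcal G,t;\mathcal F,p$, with the additional premise $\mathcal G,t;\mathcal F,p\vdash T\le t$; in the rules *-L* there are the additional premises $\mathcal G;\mathcal F\vdash T\le T'$ and $\mathcal G;\mathcal F\vdash p[T'/t]$, and $A_i'$ stands for $A_i[T'/t]$. - Cut: $\Gamma_1,\Gamma_2\vdash(\mathsf{let}^T x{:}A'\leftarrow M_1;M_2)\ @\ T::C$ if $\Gamma_1\vdash M_1\ @\ T::A$, $\ \Gamma_2,x{:}A'\vdash M_2\ @\ T::C$ and $A\ltimes A'\ @\ T$. - Fwd: $x{:}A\vdash\mathsf{fwd}^T(x)\ @\ T::A'$ if $A\rtimes A'\ @\ T$. - $1$-R: $\varnothing\vdash\mathsf{send}^{t.p}()\ @\ T::1^{t.p}$. $\quad$ $1$-L: $\Gamma,x{:}1^{t.p}\vdash(\mathsf{recv}^{T'}_x();M)\ @\ T::C$ if $\Gamma\vdash M\ @\ T'::C$. - $\multimap$-R: $\Gamma\vdash\mathsf{recv}^{t.p}(x\Rightarrow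 M)\ @\ T::A_1\multimap^{t.p}A_2$ if $\Gamma,x{:}A_1\vdash M\ @\ t::A_2$. $\quad$ $\multimap$-L: $\Gamma_1,\Gamma_2,x{:}A_1\multimap^{t.p}A_2\vdash(\mathsf{send}^{T'}_x(M_1);M_2)\ @\ T::C$ if $\Gamma_1\vdash M_1\ @\ T'::A_1'$ and $\Gamma_2,x{:}A_2'\vdash M_2\ @\ T'::C$. - $\otimes$-R: $\Gamma_1,\Gamma_2\vdash(\mathsf{send}^{t.p}(M_1);M_2)\ @\ T::A_1\otimes^{t.p}A_2$ if $\Gamma_i\vdash M_i\ @\ t::A_i$ for $i=1,2$. $\quad$ $\otimes$-L: $\Gamma,x{:}A_1\otimes^{t.p}A_2\vdash\mathsf{recv}^{T'}_x(y\Rightarrow M)\ @\ T::C$ if $\Gamma,x{:}A_2',y{:}A_1'\vdash M\ @\ T'::C$. - $\&$-R: $\Gamma\vdash\mathsf{recv}^{t.p}(\pi_1\Rightarrow M_1\mid\pi_2\Rightarrow M_2)\ @\ T::A_1\,\&^{t.p}A_2$ if $\Gamma\vdash M_i\ @\ t::A_i$ for $i=1,2$. $\quad$ $\&$-L: $\Gamma,x{:}A_1\,\&^{t.p}A_2\vdash(\mathsf{send}^{T'}_x(\pi_i);M)\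 @\ T::C$ if $\Gamma,x{:}A_i'\vdash M\ @\ T'::C$. - $\oplus$-R: $\Gamma\vdash(\mathsf{send}^{t.p}(\pi_i);M)\ @\ T::A_1\oplus^{t.p}A_2$ if $\Gamma\vdash M\ @\ t::A_i$. $\quad$ $\oplus$-L: $\Gamma,x{:}A_1\oplus^{t.p}A_2\vdash\mathsf{recv}^{T'}_x(\pi_1\Rightarrow M_1\mid\pi_2\Rightarrow M_2)\ @\ T::C$ if $\Gamma,x{:}A_i'\vdash M_i\ @\ T'::C$ for $i=1,2$. A *complementary configuration* for a context $\Gamma$ without free time variables at time $T$ is a finite partial map $\delta$ from variables to $\mathcal L\times\mathcal S[T,\infty)$ with the same domain as $\Gamma$ such that $\delta(x)=(a,w)$ implies $w\in\mathcal E[\![\Gamma(x)]\!]_T^{\text{client}}$. Let $\mathrm{subst}(\delta)$ be the map $x\mapsto a$, and $\delta(P)=\big(\biguplus_{(a,w)\in\delta}\mathrm{start}(w)[a],\,P\big)$ for $P\in\mathrm{NObj}$. **Theorem (fundamental theorem of the logical relation).** Suppose $\mathcal G;\mathcal F\mid\Gamma\vdash M\ @\ T::A$. Then for every instantiation of the time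 variables in $\mathcal G$ that makes all propositions of $\mathcal F$ true (and applied to $\Gamma,M,T,A$ below), and for every complementary configuration $\delta$ for $\Gamma$ at time $T$, there is a computable trajectory $w:\mathcal S[T,\infty)$ such that $\mathrm{start}(w)=\delta\big(\widehat{\mathrm{subst}(\delta)}(M)\big)$ and $w\in\mathcal E[\![A]\!]_T^{\text{provider}}$. -/

import Mathlib

universe u

namespace TimedILLST

/-! ### Names and finite maps -/

/-- Channel names: a fixed countably infinite set of identifiers. -/
abbrev Label := ℕ

/-- Variables of the process language. -/
abbrev Var := ℕ

/-- Finite partial maps from variables. -/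
abbrev FMap (X : Type*) := Finmap (fun _ : Var => X)

/-- Apply a function to the values of a finite map, leaving the keys unchanged. -/
def FMap.mapVal {X Y : Type*} (f : X → Y) (m : FMap X) : FMap Y where
  entries := m.entries.map (Sigma.map id (fun _ => f))
  nodupKeys := by
    rw [← Multiset.nodup_keys]
    have h := Multiset.nodup_keys.2 m.nodupKeys
    simpa [Multiset.keys, Multiset.map_map, Function.comp_def, Sigma.map] using h

/-- Two finite maps are related by `R`: at every key either both are undefined, or both are
defined with `R`-related values. -/
def FMap.Related {X Y : Type*} (R : X → Y → Prop) (m : FMap X) (m' : FMap Y) : Prop :=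
  ∀ x : Var, Option.Rel R (m.lookup x) (m'.lookup x)

/-! ### Actions -/

/-- Boolean selectors: `false` is `π₁` and `true` is `π₂`. -/
abbrev Selector := Bool

/-- The `i`-th of two alternatives. -/
def sel {X : Sort*} (i : Selector) (x₁ x₂ : X) : X :=
  match i with
  | false => x₁
  | true => x₂

inductive Payload where
  | selector (i : Selector)
  | close
  | chan (a : Label)

inductive Action where
  /-- the silent action `ε` -/
  | eps
  /-- `a ! p` -/
  | send (a : Label) (p : Payload)
  /-- `a ? p` -/
  | recv (a : Label) (p : Payload)

/-! ### Process languages and configurations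

`𝕋` is the set of finite times, an arbitrary (decidable) strict total order. -/

/-- Atomic processes over a set of nameless objects. -/
inductive Atomic (X : Type*) where
  /-- the object `P` providing the channel `a` -/
  | proc (a : Label) (P : X)
  /-- a forwarder that provides `a` and forwards to `b` -/
  | fwd (a b : Label)

def Atomic.map {X Y : Type*} (f : X → Y) : Atomic X → Atomic Y
  | .proc a P => .proc a (f P)
  | .fwd a b => .fwd a b

/-- A process language: nameless objects, and a transition relation that takes a named object to a
finite multiset of atomic processes. -/
structure ProcLang (𝕋 : Type u) : Type (u + 1) where
  Obj : Type u
  ObjStep : Obj → Label → Action → 𝕋 → Multiset (Atomic Obj) → Prop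

/-- Nameless objects of arbitrary process languages. -/
abbrev NObj (𝕋 : Type u) : Type (u + 1) := Σ S : ProcLang 𝕋, S.Obj

/-- Configurations. -/
abbrev Cfg (𝕋 : Type u) : Type (u + 1) := Multiset (Atomic (NObj 𝕋))

/-- Nameless configurations: a configuration and a nameless root object. -/
abbrev NCfg (𝕋 : Type u) : Type (u + 1) := Cfg 𝕋 × NObj 𝕋

/-- `Ω[a]`: name the root object `a`. -/
def NCfg.inst {𝕋 : Type u} (Ω : NCfg 𝕋) (a : Label) : Cfg 𝕋 := Ω.1 + {Atomic.proc a Ω.2}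

/-- Join a configuration to a nameless configuration. -/
def NCfg.join {𝕋 : Type u} (Ω : NCfg 𝕋) (Ω₀ : Cfg 𝕋) : NCfg 𝕋 := (Ω.1 + Ω₀, Ω.2)

/-- Labelled transitions of configurations at a given time. -/
inductive Step {𝕋 : Type u} : Cfg 𝕋 → Action → 𝕋 → Cfg 𝕋 → Prop
  | obj {S : ProcLang 𝕋} {P : S.Obj} {a : Label} {α : Action} {T : 𝕋}
      {Ω' : Multiset (Atomic S.Obj)} :
      S.ObjStep P a α T Ω' →
      Step {Atomic.proc a ⟨S, P⟩} α T (Ω'.map (Atomic.map (Sigma.mk S)))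
  | frame {Ω Ω' Ω₀ : Cfg 𝕋} {α : Action} {T : 𝕋} :
      Step Ω α T Ω' → Step (Ω + Ω₀) α T (Ω' + Ω₀)
  | fwd {a b : Label} {P : NObj 𝕋} {T : 𝕋} :
      Step {Atomic.proc a P, Atomic.fwd b a} .eps T {Atomic.proc b P}
  | comm {Ω₁ Ω₁' Ω₂ Ω₂' : Cfg 𝕋} {a : Label} {c : Payload} {T : 𝕋} :
      Step Ω₁ (.send a c) T Ω₁' → Step Ω₂ (.recv a c) T Ω₂' →
      Step (Ω₁ + Ω₂) .eps T (Ω₁' + Ω₂')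

/-! ### Multistepping and computable trajectories -/

section Trajectories

variable {𝕋 : Type u} [LinearOrder 𝕋]

/-- Proof-relevant silent multistepping from a configuration at a time to a configuration at a
time. -/
inductive MultiStep : Cfg 𝕋 → 𝕋 → Cfg 𝕋 → 𝕋 → Type (u + 1)
  | refl (Ω : Cfg 𝕋) (T : 𝕋) : MultiStep Ω T Ω T
  | stepT {Ω Ω' : Cfg 𝕋} {T₁ T₂ T₃ : 𝕋} (h : T₁ ≤ T₂) (σ : MultiStep Ω T₂ Ω' T₃) :
      MultiStep Ω T₁ Ω' T₃
  | stepC {Ω Ω' Ω'' : Cfg 𝕋} {T₁ T₂ : 𝕋} (h : Step Ω .eps T₁ Ω') (σ : MultiStep Ω' T₁ Ω'' T₂) :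
      MultiStep Ω T₁ Ω'' T₂

/-- Functions on the time interval `[T, ∞)`. -/
abbrev Traj (X : Type*) (T : 𝕋) := Set.Ici T → X

/-- Extend a trajectory on `[T₁, ∞)` to `[T, ∞)` by the constant value `x` on `[T, T₁)`. -/
def Traj.extend {X : Type*} {T₁ : 𝕋} (x : X) (T : 𝕋) (s : Traj X T₁) : Traj X T :=
  fun t => if h : T₁ ≤ t.1 then s ⟨t.1, h⟩ else x

/-- A trajectory on `[T, ∞)` is realized by a multistepping. -/
inductive Realizes : {Ω Ω' : Cfg 𝕋} → {T T' : 𝕋} → Traj (Cfg 𝕋) T → MultiStep Ω T Ω' T' → Prop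
  | refl (Ω : Cfg 𝕋) (T : 𝕋) : Realizes (fun _ => Ω) (MultiStep.refl Ω T)
  | stepT {Ω Ω' : Cfg 𝕋} {T₁ T₂ T₃ : 𝕋} (h : T₁ ≤ T₂) {s : Traj (Cfg 𝕋) T₂}
      {σ : MultiStep Ω T₂ Ω' T₃} :
      Realizes s σ → Realizes (Traj.extend Ω T₁ s) (MultiStep.stepT h σ)
  | stepC {Ω Ω' Ω'' : Cfg 𝕋} {T₁ T₂ : 𝕋} (h : Step Ω .eps T₁ Ω') {s : Traj (Cfg 𝕋) T₁}
      {σ : MultiStep Ω' T₁ Ω'' T₂} :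
      Realizes s σ → Realizes s (MultiStep.stepC h σ)

/-- Computable trajectories on `[T, ∞)`. -/
structure CompTraj (T : 𝕋) : Type (u + 1) where
  start : NCfg 𝕋
  finish : NCfg 𝕋
  traj : Traj (NCfg 𝕋) T
  stepTo : Label → 𝕋
  steps : ∀ a : Label, MultiStep (start.inst a) T (finish.inst a) (stepTo a)
  realize : ∀ a : Label, Realizes (fun t => (traj t).inst a) (steps a)

end Trajectories

/-! ### Timed session types -/

/-- Timed types without free time variables, in higher-order representation: the temporal
predicate `t.p` is a predicate on times, and the components, which lie in the scope of the bound
time variable `t`, are functions of the time. -/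
inductive Ty (𝕋 : Type u) : Type u
  | one (p : 𝕋 → Prop)
  | lolli (p : 𝕋 → Prop) (A₁ A₂ : 𝕋 → Ty 𝕋)
  | tensor (p : 𝕋 → Prop) (A₁ A₂ : 𝕋 → Ty 𝕋)
  | with (p : 𝕋 → Prop) (A₁ A₂ : 𝕋 → Ty 𝕋)
  | plus (p : 𝕋 → Prop) (A₁ A₂ : 𝕋 → Ty 𝕋)

/-- The proposition of the outermost temporal predicate, at a given time. -/
def Ty.prop {𝕋 : Type u} : Ty 𝕋 → 𝕋 → Prop
  | .one p => p
  | .lolli p _ _ => p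
  | .tensor p _ _ => p
  | .with p _ _ => p
  | .plus p _ _ => p

/-! ### The logical relation -/

/-- Is an inhabitant provided (to be shown) or used by a client (assumed)? -/
inductive Mode where
  | provider
  | client

def Mode.inv : Mode → Mode
  | .provider => .client
  | .client => .provider

section LogicalRelation

variable {𝕋 : Type u} [LinearOrder 𝕋]

/-- The term interpretation at time `T`, from the proposition `p` of the type and its value
interpretation `V` in mode `d`. -/
def TermRel (p : 𝕋 → Prop) (V : 𝕋 → NCfg 𝕋 → Prop) (d : Mode) (T : 𝕋) (w : CompTraj T) : Prop :=
  match d with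
  | .client => ∀ (T' : 𝕋) (h : T ≤ T'), p T' → V T' (w.traj ⟨T', h⟩)
  | .provider => ∀ T' : 𝕋, p T' → ∃ h : T ≤ T', V T' (w.traj ⟨T', h⟩)

/-- The value interpretation `Ω ∈ 𝒱⟦A⟧` at time `T` in mode `d`. The components of the type are
instantiated with the time `T` of the exchange. -/
def ValueInterp : Ty 𝕋 → Mode → 𝕋 → NCfg 𝕋 → Prop
  | .one _, _, T, Ω => ∀ a : Label, Step (Ω.inst a) (.send a .close) T 0
  | .tensor _ A₁ A₂, d, T, Ω => ∀ a : Label, ∃ (c : Label) (w₁ w₂ : CompTraj T),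
      TermRel (A₁ T).prop (fun T' => ValueInterp (A₁ T) d T') d T w₁ ∧
      TermRel (A₂ T).prop (fun T' => ValueInterp (A₂ T) d T') d T w₂ ∧
      Step (Ω.inst a) (.send a (.chan c)) T (w₁.start.inst c + w₂.start.inst a)
  | .lolli _ A₁ A₂, d, T, Ω => ∀ (a : Label) (w₁ : CompTraj T),
      TermRel (A₁ T).prop (fun T' => ValueInterp (A₁ T) d.inv T') d.inv T w₁ →
      ∀ c : Label, ∃ (Ω₂ : NCfg 𝕋) (w₂ : CompTraj T),
        TermRel (A₂ T).prop (fun T' => ValueInterp (A₂ T) d T') d T w₂ ∧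
        Step (Ω.inst a) (.recv a (.chan c)) T (Ω₂.inst a) ∧
        w₂.start = Ω₂.join (w₁.start.inst c)
  | .with _ A₁ A₂, d, T, Ω =>
      (∀ a : Label, ∃ w₁ : CompTraj T,
        TermRel (A₁ T).prop (fun T' => ValueInterp (A₁ T) d T') d T w₁ ∧
        Step (Ω.inst a) (.recv a (.selector false)) T (w₁.start.inst a)) ∧
      (∀ a : Label, ∃ w₂ : CompTraj T,
        TermRel (A₂ T).prop (fun T' => ValueInterp (A₂ T) d T') d T w₂ ∧
        Step (Ω.inst a) (.recv a (.selector true)) T (w₂.start.inst a))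
  | .plus _ A₁ A₂, d, T, Ω =>
      (∀ a : Label, ∃ w₁ : CompTraj T,
        TermRel (A₁ T).prop (fun T' => ValueInterp (A₁ T) d T') d T w₁ ∧
        Step (Ω.inst a) (.send a (.selector false)) T (w₁.start.inst a)) ∨
      (∀ a : Label, ∃ w₂ : CompTraj T,
        TermRel (A₂ T).prop (fun T' => ValueInterp (A₂ T) d T') d T w₂ ∧
        Step (Ω.inst a) (.send a (.selector true)) T (w₂.start.inst a))

/-- The term interpretation `w ∈ ℰ⟦A⟧` at time `T` in mode `d`. -/
def TermInterp (A : Ty 𝕋) (d : Mode) (T : 𝕋) (w : CompTraj T) : Prop :=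
  TermRel A.prop (ValueInterp A d) d T w

end LogicalRelation

/-! ### The process language -/

/-- Symbols: channel names or variables. -/
inductive Sym where
  | chan (a : Label)
  | var (x : Var)

/-- Process terms without free time variables. A subterm in the scope of a time variable bound by
a temporal predicate `t.p` is a function of the time. -/
inductive Term (𝕋 : Type u) : Type u
  /-- `fwd^T (s)` -/
  | fwd (T : 𝕋) (s : Sym)
  /-- `let^T x : A ← M₁; M₂` -/
  | cut (T : 𝕋) (x : Var) (A : Ty 𝕋) (M₁ M₂ : Term 𝕋)
  /-- `send^{t.p} ()` -/
  | oneR (p : 𝕋 → Prop)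
  /-- `recv^T_s (); M` -/
  | oneL (T : 𝕋) (s : Sym) (M : Term 𝕋)
  /-- `recv^{t.p} (x ⇒ M)` -/
  | lolliR (p : 𝕋 → Prop) (x : Var) (M : 𝕋 → Term 𝕋)
  /-- `send^T_s (M₁); M₂` -/
  | lolliL (T : 𝕋) (s : Sym) (M₁ M₂ : Term 𝕋)
  /-- `send^{t.p} (M₁); M₂` -/
  | tensorR (p : 𝕋 → Prop) (M₁ M₂ : 𝕋 → Term 𝕋)
  /-- `recv^T_s (y ⇒ M)` -/
  | tensorL (T : 𝕋) (s : Sym) (y : Var) (M : Term 𝕋)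
  /-- `recv^{t.p} (π₁ ⇒ M₁ | π₂ ⇒ M₂)` -/
  | withR (p : 𝕋 → Prop) (M₁ M₂ : 𝕋 → Term 𝕋)
  /-- `send^T_s (i); M` -/
  | withL (T : 𝕋) (s : Sym) (i : Selector) (M : Term 𝕋)
  /-- `send^{t.p} (i); M` -/
  | plusR (p : 𝕋 → Prop) (i : Selector) (M : 𝕋 → Term 𝕋)
  /-- `recv^T_s (π₁ ⇒ M₁ | π₂ ⇒ M₂)` -/
  | plusL (T : 𝕋) (s : Sym) (M₁ M₂ : Term 𝕋)

/-- Substitutions of channel names for variables. -/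
abbrev Subst := FMap Label

/-- The symbol that `σ` assigns to a symbol; a variable outside of the domain is kept. -/
def Subst.sym (σ : Subst) : Sym → Sym
  | .chan a => .chan a
  | .var x =>
    match σ.lookup x with
    | some a => .chan a
    | none => .var x

/-- Remove a symbol from a substitution. -/
def Subst.remove (σ : Subst) : Sym → Subst
  | .chan _ => σ
  | .var x => σ.erase x

/-- Apply a substitution to a process term. -/
def Term.subst {𝕋 : Type u} : Subst → Term 𝕋 → Term 𝕋
  | σ, .fwd T s => .fwd T (σ.sym s)
  | σ, .cut T x A M₁ M₂ => .cut T x A (M₁.subst σ) (M₂.subst (σ.erase x))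
  | _, .oneR p => .oneR p
  | σ, .oneL T s M => .oneL T (σ.sym s) (M.subst (σ.remove s))
  | σ, .lolliR p x M => .lolliR p x (fun t => (M t).subst (σ.erase x))
  | σ, .lolliL T s M₁ M₂ => .lolliL T (σ.sym s) (M₁.subst σ) (M₂.subst σ)
  | σ, .tensorR p M₁ M₂ => .tensorR p (fun t => (M₁ t).subst σ) (fun t => (M₂ t).subst σ)
  | σ, .tensorL T s y M => .tensorL T (σ.sym s) y (M.subst (σ.erase y))
  | σ, .withR p M₁ M₂ => .withR p (fun t => (M₁ t).subst σ) (fun t => (M₂ t).subst σ)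
  | σ, .withL T s i M => .withL T (σ.sym s) i (M.subst σ)
  | σ, .plusR p i M => .plusR p i (fun t => (M t).subst σ)
  | σ, .plusL T s M₁ M₂ => .plusL T (σ.sym s) (M₁.subst σ) (M₂.subst σ)

/-- The substitution of the single name `b` for the variable `x`. -/
abbrev Term.subst₁ {𝕋 : Type u} (b : Label) (x : Var) (M : Term 𝕋) : Term 𝕋 :=
  M.subst (Finmap.singleton x b)

/-- Object-level stepping: `TermStep M a α T Ω` says that `M`, named `a`, steps to `Ω` with action
`α` at time `T`. Terms annotated with a time step at that time; terms annotated with a temporal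
predicate step at every time that satisfies it, and the bound time variable becomes that time. -/
inductive TermStep {𝕋 : Type u} : Term 𝕋 → Label → Action → 𝕋 → Multiset (Atomic (Term 𝕋)) → Prop
  | fwd (T : 𝕋) (a b : Label) : TermStep (.fwd T (.chan b)) a .eps T {Atomic.fwd a b}
  | cut (T : 𝕋) (x : Var) (A : Ty 𝕋) (M₁ M₂ : Term 𝕋) (a b : Label) :
      TermStep (.cut T x A M₁ M₂) a .eps T {Atomic.proc b M₁, Atomic.proc a (M₂.subst₁ b x)}
  | oneL (T : 𝕋) (M : Term 𝕋) (a b : Label) :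
      TermStep (.oneL T (.chan b) M) a (.recv b .close) T {Atomic.proc a M}
  | tensorL (T : 𝕋) (y : Var) (M : Term 𝕋) (a b c : Label) :
      TermStep (.tensorL T (.chan b) y M) a (.recv b (.chan c)) T {Atomic.proc a (M.subst₁ c y)}
  | lolliL (T : 𝕋) (M₁ M₂ : Term 𝕋) (a b c : Label) :
      TermStep (.lolliL T (.chan b) M₁ M₂) a (.send b (.chan c)) T
        {Atomic.proc c M₁, Atomic.proc a M₂}
  | plusL (T : 𝕋) (M₁ M₂ : Term 𝕋) (a b : Label) (i : Selector) :
      TermStep (.plusL T (.chan b) M₁ M₂) a (.recv b (.selector i)) T {Atomic.proc a (sel i M₁ M₂)}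
  | withL (T : 𝕋) (i : Selector) (M : Term 𝕋) (a b : Label) :
      TermStep (.withL T (.chan b) i M) a (.send b (.selector i)) T {Atomic.proc a M}
  | oneR (p : 𝕋 → Prop) (a : Label) (T : 𝕋) : p T →
      TermStep (.oneR p) a (.send a .close) T 0
  | tensorR (p : 𝕋 → Prop) (M₁ M₂ : 𝕋 → Term 𝕋) (a c : Label) (T : 𝕋) : p T →
      TermStep (.tensorR p M₁ M₂) a (.send a (.chan c)) T
        {Atomic.proc a (M₂ T), Atomic.proc c (M₁ T)}
  | lolliR (p : 𝕋 → Prop) (x : Var) (M : 𝕋 → Term 𝕋) (a b : Label) (T : 𝕋) : p T →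
      TermStep (.lolliR p x M) a (.recv a (.chan b)) T {Atomic.proc a ((M T).subst₁ b x)}
  | plusR (p : 𝕋 → Prop) (i : Selector) (M : 𝕋 → Term 𝕋) (a : Label) (T : 𝕋) : p T →
      TermStep (.plusR p i M) a (.send a (.selector i)) T {Atomic.proc a (M T)}
  | withR (p : 𝕋 → Prop) (M₁ M₂ : 𝕋 → Term 𝕋) (a : Label) (i : Selector) (T : 𝕋) : p T →
      TermStep (.withR p M₁ M₂) a (.recv a (.selector i)) T {Atomic.proc a (sel i M₁ M₂ T)}

/-- The process language of timed ILLST terms. -/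
def illst (𝕋 : Type u) : ProcLang 𝕋 where
  Obj := Term 𝕋
  ObjStep := TermStep

/-! ### Time contexts and open objects

A time context is a number `n` of time variables, interpreted by its instantiations
`Fin n → 𝕋`; an extended context has the new variable at index `0`. Propositions, times, types and
terms over a time context are functions of the instantiation. -/

/-- Instantiations of `n` time variables. -/
abbrev TimeEnv (𝕋 : Type u) (n : ℕ) := Fin n → 𝕋

/-- Extend an instantiation by a time for a new variable. -/
def TimeEnv.ext {𝕋 : Type u} {n : ℕ} (g : TimeEnv 𝕋 n) (t : 𝕋) : TimeEnv 𝕋 (n + 1) :=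
  Fin.cons t g

/-- The instantiation of the old variables. -/
def TimeEnv.old {𝕋 : Type u} {n : ℕ} (g : TimeEnv 𝕋 (n + 1)) : TimeEnv 𝕋 n := Fin.tail g

/-- The time of the newest variable. -/
def TimeEnv.new {𝕋 : Type u} {n : ℕ} (g : TimeEnv 𝕋 (n + 1)) : 𝕋 := g 0

/-- Objects of kind `X` over `n` time variables. -/
abbrev Open (𝕋 : Type u) (n : ℕ) (X : Type*) := TimeEnv 𝕋 n → X

section OpenObjects

variable {𝕋 : Type u} {n : ℕ} {X : Type*}

/-- Weakening by a new time variable. -/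
def Open.wk (e : Open 𝕋 n X) : Open 𝕋 (n + 1) X := fun g => e g.old

/-- The substitution `e[T/t]` of a time expression for the newest variable. -/
def Open.at (e : Open 𝕋 (n + 1) X) (T : Open 𝕋 n 𝕋) : Open 𝕋 n X := fun g => e (g.ext (T g))

/-- Abstraction `t.e` over the newest variable. -/
def Open.bind (e : Open 𝕋 (n + 1) X) (g : TimeEnv 𝕋 n) : 𝕋 → X := fun t => e (g.ext t)

end OpenObjects

/-- Contexts of assumed propositions over `n` time variables. -/
abbrev PropCtx (𝕋 : Type u) (n : ℕ) := List (Open 𝕋 n Prop)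

/-- Typing contexts over `n` time variables. -/
abbrev Ctx (𝕋 : Type u) (n : ℕ) := FMap (Open 𝕋 n (Ty 𝕋))

section Contexts

variable {𝕋 : Type u} {n : ℕ}

/-- An instantiation makes all propositions of the context true. -/
def PropCtx.Holds (F : PropCtx 𝕋 n) (g : TimeEnv 𝕋 n) : Prop := ∀ φ ∈ F, φ g

/-- `𝒢; ℱ ⊢ φ`. -/
def PropCtx.Entails (F : PropCtx 𝕋 n) (φ : Open 𝕋 n Prop) : Prop :=
  ∀ g : TimeEnv 𝕋 n, F.Holds g → φ g

/-- The context `𝒢, t; ℱ, p`, where `p` may use `t`. -/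
def PropCtx.ext (F : PropCtx 𝕋 n) (p : Open 𝕋 (n + 1) Prop) : PropCtx 𝕋 (n + 1) :=
  p :: F.map Open.wk

def Ctx.wk (Γ : Ctx 𝕋 n) : Ctx 𝕋 (n + 1) := FMap.mapVal Open.wk Γ

/-- Instantiate the time variables in a typing context. -/
def Ctx.inst (Γ : Ctx 𝕋 n) (g : TimeEnv 𝕋 n) : FMap (Ty 𝕋) := FMap.mapVal (fun A => A g) Γ

/-- `T ≤ T'` as a proposition over the time variables. -/
def leProp [LinearOrder 𝕋] (T T' : Open 𝕋 n 𝕋) : Open 𝕋 n Prop := fun g => T g ≤ T' g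

end Contexts

/-! Types with free time variables. -/

section OpenTypes

variable {𝕋 : Type u} {n : ℕ}

def oneTy (p : Open 𝕋 (n + 1) Prop) : Open 𝕋 n (Ty 𝕋) := fun g => .one (p.bind g)

def lolliTy (p : Open 𝕋 (n + 1) Prop) (A₁ A₂ : Open 𝕋 (n + 1) (Ty 𝕋)) : Open 𝕋 n (Ty 𝕋) :=
  fun g => .lolli (p.bind g) (A₁.bind g) (A₂.bind g)

def tensorTy (p : Open 𝕋 (n + 1) Prop) (A₁ A₂ : Open 𝕋 (n + 1) (Ty 𝕋)) : Open 𝕋 n (Ty 𝕋) :=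
  fun g => .tensor (p.bind g) (A₁.bind g) (A₂.bind g)

def withTy (p : Open 𝕋 (n + 1) Prop) (A₁ A₂ : Open 𝕋 (n + 1) (Ty 𝕋)) : Open 𝕋 n (Ty 𝕋) :=
  fun g => .with (p.bind g) (A₁.bind g) (A₂.bind g)

def plusTy (p : Open 𝕋 (n + 1) Prop) (A₁ A₂ : Open 𝕋 (n + 1) (Ty 𝕋)) : Open 𝕋 n (Ty 𝕋) :=
  fun g => .plus (p.bind g) (A₁.bind g) (A₂.bind g)

end OpenTypes

/-! ### Retyping -/

section Typing

variable {𝕋 : Type u} [LinearOrder 𝕋]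

/-- `𝒢; ℱ ⊢ A ⋊ B @ T`: from a client's view of `A` to a provider's view of `B`. -/
inductive RetypeR : {n : ℕ} → PropCtx 𝕋 n → Open 𝕋 n (Ty 𝕋) → Open 𝕋 n (Ty 𝕋) →
    Open 𝕋 n 𝕋 → Prop
  | one {n : ℕ} {F : PropCtx 𝕋 n} {T : Open 𝕋 n 𝕋} {p q : Open 𝕋 (n + 1) Prop} :
      (F.ext q).Entails p → (F.ext q).Entails (leProp T.wk TimeEnv.new) →
      RetypeR F (oneTy p) (oneTy q) T
  | lolli {n : ℕ} {F : PropCtx 𝕋 n} {T : Open 𝕋 n 𝕋} {p q : Open 𝕋 (n + 1) Prop}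
      {A₁ A₂ B₁ B₂ : Open 𝕋 (n + 1) (Ty 𝕋)} :
      (F.ext q).Entails p → (F.ext q).Entails (leProp T.wk TimeEnv.new) →
      RetypeR (F.ext q) B₁ A₁ TimeEnv.new → RetypeR (F.ext q) A₂ B₂ TimeEnv.new →
      RetypeR F (lolliTy p A₁ A₂) (lolliTy q B₁ B₂) T
  | tensor {n : ℕ} {F : PropCtx 𝕋 n} {T : Open 𝕋 n 𝕋} {p q : Open 𝕋 (n + 1) Prop}
      {A₁ A₂ B₁ B₂ : Open 𝕋 (n + 1) (Ty 𝕋)} :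
      (F.ext q).Entails p → (F.ext q).Entails (leProp T.wk TimeEnv.new) →
      RetypeR (F.ext q) A₁ B₁ TimeEnv.new → RetypeR (F.ext q) A₂ B₂ TimeEnv.new →
      RetypeR F (tensorTy p A₁ A₂) (tensorTy q B₁ B₂) T
  | with {n : ℕ} {F : PropCtx 𝕋 n} {T : Open 𝕋 n 𝕋} {p q : Open 𝕋 (n + 1) Prop}
      {A₁ A₂ B₁ B₂ : Open 𝕋 (n + 1) (Ty 𝕋)} :
      (F.ext q).Entails p → (F.ext q).Entails (leProp T.wk TimeEnv.new) →
      RetypeR (F.ext q) A₁ B₁ TimeEnv.new → RetypeR (F.ext q) A₂ B₂ TimeEnv.new →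
      RetypeR F (withTy p A₁ A₂) (withTy q B₁ B₂) T
  | plus {n : ℕ} {F : PropCtx 𝕋 n} {T : Open 𝕋 n 𝕋} {p q : Open 𝕋 (n + 1) Prop}
      {A₁ A₂ B₁ B₂ : Open 𝕋 (n + 1) (Ty 𝕋)} :
      (F.ext q).Entails p → (F.ext q).Entails (leProp T.wk TimeEnv.new) →
      RetypeR (F.ext q) A₁ B₁ TimeEnv.new → RetypeR (F.ext q) A₂ B₂ TimeEnv.new →
      RetypeR F (plusTy p A₁ A₂) (plusTy q B₁ B₂) T

/-- The context `𝒢, t; ℱ, T ≤ t, q`. -/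
def PropCtx.extLe {n : ℕ} (F : PropCtx 𝕋 n) (T : Open 𝕋 n 𝕋) (q : Open 𝕋 (n + 1) Prop) :
    PropCtx 𝕋 (n + 1) :=
  q :: F.ext (leProp T.wk TimeEnv.new)

/-- `𝒢; ℱ ⊢ A ⋉ B @ T`: from a provider's view of `A` to a client's view of `B`. -/
inductive RetypeL : {n : ℕ} → PropCtx 𝕋 n → Open 𝕋 n (Ty 𝕋) → Open 𝕋 n (Ty 𝕋) →
    Open 𝕋 n 𝕋 → Prop
  | one {n : ℕ} {F : PropCtx 𝕋 n} {T : Open 𝕋 n 𝕋} {p q : Open 𝕋 (n + 1) Prop} :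
      (F.extLe T q).Entails p →
      RetypeL F (oneTy p) (oneTy q) T
  | lolli {n : ℕ} {F : PropCtx 𝕋 n} {T : Open 𝕋 n 𝕋} {p q : Open 𝕋 (n + 1) Prop}
      {A₁ A₂ B₁ B₂ : Open 𝕋 (n + 1) (Ty 𝕋)} :
      (F.extLe T q).Entails p →
      RetypeL (F.extLe T q) B₁ A₁ TimeEnv.new → RetypeL (F.extLe T q) A₂ B₂ TimeEnv.new →
      RetypeL F (lolliTy p A₁ A₂) (lolliTy q B₁ B₂) T
  | tensor {n : ℕ} {F : PropCtx 𝕋 n} {T : Open 𝕋 n 𝕋} {p q : Open 𝕋 (n + 1) Prop}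
      {A₁ A₂ B₁ B₂ : Open 𝕋 (n + 1) (Ty 𝕋)} :
      (F.extLe T q).Entails p →
      RetypeL (F.extLe T q) A₁ B₁ TimeEnv.new → RetypeL (F.extLe T q) A₂ B₂ TimeEnv.new →
      RetypeL F (tensorTy p A₁ A₂) (tensorTy q B₁ B₂) T
  | with {n : ℕ} {F : PropCtx 𝕋 n} {T : Open 𝕋 n 𝕋} {p q : Open 𝕋 (n + 1) Prop}
      {A₁ A₂ B₁ B₂ : Open 𝕋 (n + 1) (Ty 𝕋)} :
      (F.extLe T q).Entails p →
      RetypeL (F.extLe T q) A₁ B₁ TimeEnv.new → RetypeL (F.extLe T q) A₂ B₂ TimeEnv.new →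
      RetypeL F (withTy p A₁ A₂) (withTy q B₁ B₂) T
  | plus {n : ℕ} {F : PropCtx 𝕋 n} {T : Open 𝕋 n 𝕋} {p q : Open 𝕋 (n + 1) Prop}
      {A₁ A₂ B₁ B₂ : Open 𝕋 (n + 1) (Ty 𝕋)} :
      (F.extLe T q).Entails p →
      RetypeL (F.extLe T q) A₁ B₁ TimeEnv.new → RetypeL (F.extLe T q) A₂ B₂ TimeEnv.new →
      RetypeL F (plusTy p A₁ A₂) (plusTy q B₁ B₂) T

/-! ### Typing -/

/-- `𝒢; ℱ ∣ Γ ⊢ M @ T :: A`. Contexts are joined only when they are disjoint, and extended only at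
variables that they do not contain. -/
inductive HasType : {n : ℕ} → PropCtx 𝕋 n → Ctx 𝕋 n → Open 𝕋 n (Term 𝕋) → Open 𝕋 n 𝕋 →
    Open 𝕋 n (Ty 𝕋) → Prop
  | cut {n : ℕ} {F : PropCtx 𝕋 n} {Γ₁ Γ₂ : Ctx 𝕋 n} {M₁ M₂ : Open 𝕋 n (Term 𝕋)}
      {T : Open 𝕋 n 𝕋} {A A' C : Open 𝕋 n (Ty 𝕋)} {x : Var} :
      HasType F Γ₁ M₁ T A → HasType F (Γ₂.insert x A') M₂ T C → RetypeL F A A' T →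
      Γ₁.Disjoint Γ₂ → x ∉ Γ₂ →
      HasType F (Γ₁ ∪ Γ₂) (fun g => .cut (T g) x (A' g) (M₁ g) (M₂ g)) T C
  | fwd {n : ℕ} {F : PropCtx 𝕋 n} {T : Open 𝕋 n 𝕋} {A A' : Open 𝕋 n (Ty 𝕋)} {x : Var} :
      RetypeR F A A' T →
      HasType F (Finmap.singleton x A) (fun g => .fwd (T g) (.var x)) T A'
  | oneR {n : ℕ} {F : PropCtx 𝕋 n} {T : Open 𝕋 n 𝕋} {p : Open 𝕋 (n + 1) Prop} :
      (F.ext p).Entails (leProp T.wk TimeEnv.new) →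
      HasType F ∅ (fun g => .oneR (p.bind g)) T (oneTy p)
  | oneL {n : ℕ} {F : PropCtx 𝕋 n} {Γ : Ctx 𝕋 n} {M : Open 𝕋 n (Term 𝕋)} {T T' : Open 𝕋 n 𝕋}
      {C : Open 𝕋 n (Ty 𝕋)} {p : Open 𝕋 (n + 1) Prop} {x : Var} :
      HasType F Γ M T' C → F.Entails (leProp T T') → F.Entails (p.at T') → x ∉ Γ →
      HasType F (Γ.insert x (oneTy p)) (fun g => .oneL (T' g) (.var x) (M g)) T C
  | lolliR {n : ℕ} {F : PropCtx 𝕋 n} {Γ : Ctx 𝕋 n} {M₂ : Open 𝕋 (n + 1) (Term 𝕋)}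
      {T : Open 𝕋 n 𝕋} {A₁ A₂ : Open 𝕋 (n + 1) (Ty 𝕋)} {p : Open 𝕋 (n + 1) Prop} {x : Var} :
      HasType (F.ext p) (Γ.wk.insert x A₁) M₂ TimeEnv.new A₂ →
      (F.ext p).Entails (leProp T.wk TimeEnv.new) → x ∉ Γ →
      HasType F Γ (fun g => .lolliR (p.bind g) x (M₂.bind g)) T (lolliTy p A₁ A₂)
  | lolliL {n : ℕ} {F : PropCtx 𝕋 n} {Γ₁ Γ₂ : Ctx 𝕋 n} {M₁ M₂ : Open 𝕋 n (Term 𝕋)}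
      {T T' : Open 𝕋 n 𝕋} {A₁ A₂ : Open 𝕋 (n + 1) (Ty 𝕋)} {C : Open 𝕋 n (Ty 𝕋)}
      {p : Open 𝕋 (n + 1) Prop} {x : Var} :
      HasType F Γ₁ M₁ T' (A₁.at T') → HasType F (Γ₂.insert x (A₂.at T')) M₂ T' C →
      F.Entails (leProp T T') → F.Entails (p.at T') →
      Γ₁.Disjoint Γ₂ → x ∉ Γ₁ → x ∉ Γ₂ →
      HasType F ((Γ₁ ∪ Γ₂).insert x (lolliTy p A₁ A₂))
        (fun g => .lolliL (T' g) (.var x) (M₁ g) (M₂ g)) T C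
  | tensorR {n : ℕ} {F : PropCtx 𝕋 n} {Γ₁ Γ₂ : Ctx 𝕋 n} {M₁ M₂ : Open 𝕋 (n + 1) (Term 𝕋)}
      {T : Open 𝕋 n 𝕋} {A₁ A₂ : Open 𝕋 (n + 1) (Ty 𝕋)} {p : Open 𝕋 (n + 1) Prop} :
      HasType (F.ext p) Γ₁.wk M₁ TimeEnv.new A₁ → HasType (F.ext p) Γ₂.wk M₂ TimeEnv.new A₂ →
      (F.ext p).Entails (leProp T.wk TimeEnv.new) → Γ₁.Disjoint Γ₂ →
      HasType F (Γ₁ ∪ Γ₂) (fun g => .tensorR (p.bind g) (M₁.bind g) (M₂.bind g)) T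
        (tensorTy p A₁ A₂)
  | tensorL {n : ℕ} {F : PropCtx 𝕋 n} {Γ : Ctx 𝕋 n} {M : Open 𝕋 n (Term 𝕋)}
      {T T' : Open 𝕋 n 𝕋} {A₁ A₂ : Open 𝕋 (n + 1) (Ty 𝕋)} {C : Open 𝕋 n (Ty 𝕋)}
      {p : Open 𝕋 (n + 1) Prop} {x y : Var} :
      HasType F ((Γ.insert x (A₂.at T')).insert y (A₁.at T')) M T' C →
      F.Entails (leProp T T') → F.Entails (p.at T') → x ∉ Γ → y ∉ Γ → x ≠ y →
      HasType F (Γ.insert x (tensorTy p A₁ A₂)) (fun g => .tensorL (T' g) (.var x) y (M g)) T C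
  | withR {n : ℕ} {F : PropCtx 𝕋 n} {Γ : Ctx 𝕋 n} {M₁ M₂ : Open 𝕋 (n + 1) (Term 𝕋)}
      {T : Open 𝕋 n 𝕋} {A₁ A₂ : Open 𝕋 (n + 1) (Ty 𝕋)} {p : Open 𝕋 (n + 1) Prop} :
      HasType (F.ext p) Γ.wk M₁ TimeEnv.new A₁ → HasType (F.ext p) Γ.wk M₂ TimeEnv.new A₂ →
      (F.ext p).Entails (leProp T.wk TimeEnv.new) →
      HasType F Γ (fun g => .withR (p.bind g) (M₁.bind g) (M₂.bind g)) T (withTy p A₁ A₂)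
  | withL {n : ℕ} {F : PropCtx 𝕋 n} {Γ : Ctx 𝕋 n} {M : Open 𝕋 n (Term 𝕋)}
      {T T' : Open 𝕋 n 𝕋} {A₁ A₂ : Open 𝕋 (n + 1) (Ty 𝕋)} {C : Open 𝕋 n (Ty 𝕋)}
      {p : Open 𝕋 (n + 1) Prop} {x : Var} (i : Selector) :
      HasType F (Γ.insert x ((sel i A₁ A₂).at T')) M T' C →
      F.Entails (leProp T T') → F.Entails (p.at T') → x ∉ Γ →
      HasType F (Γ.insert x (withTy p A₁ A₂)) (fun g => .withL (T' g) (.var x) i (M g)) T C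
  | plusR {n : ℕ} {F : PropCtx 𝕋 n} {Γ : Ctx 𝕋 n} {M : Open 𝕋 (n + 1) (Term 𝕋)}
      {T : Open 𝕋 n 𝕋} {A₁ A₂ : Open 𝕋 (n + 1) (Ty 𝕋)} {p : Open 𝕋 (n + 1) Prop}
      (i : Selector) :
      HasType (F.ext p) Γ.wk M TimeEnv.new (sel i A₁ A₂) →
      (F.ext p).Entails (leProp T.wk TimeEnv.new) →
      HasType F Γ (fun g => .plusR (p.bind g) i (M.bind g)) T (plusTy p A₁ A₂)
  | plusL {n : ℕ} {F : PropCtx 𝕋 n} {Γ : Ctx 𝕋 n} {M₁ M₂ : Open 𝕋 n (Term 𝕋)}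
      {T T' : Open 𝕋 n 𝕋} {A₁ A₂ : Open 𝕋 (n + 1) (Ty 𝕋)} {C : Open 𝕋 n (Ty 𝕋)}
      {p : Open 𝕋 (n + 1) Prop} {x : Var} :
      HasType F (Γ.insert x (A₁.at T')) M₁ T' C → HasType F (Γ.insert x (A₂.at T')) M₂ T' C →
      F.Entails (leProp T T') → F.Entails (p.at T') → x ∉ Γ →
      HasType F (Γ.insert x (plusTy p A₁ A₂))
        (fun g => .plusL (T' g) (.var x) (M₁ g) (M₂ g)) T C

end Typing

/-! ### Complementary configurations -/

section Complementary

variable {𝕋 : Type u} [LinearOrder 𝕋]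

/-- Finite maps from variables to computable trajectories with their providing channels. -/
abbrev Compl (T : 𝕋) := FMap (Label × CompTraj T)

/-- `δ` is a complementary configuration for `Γ`. -/
def TypedCompl (T : 𝕋) (Γ : FMap (Ty 𝕋)) (δ : Compl T) : Prop :=
  FMap.Related (fun e A => TermInterp A .client T e.2) δ Γ

/-- The substitution underlying `δ`. -/
def substOf {T : 𝕋} (δ : Compl T) : Subst := FMap.mapVal Prod.fst δ

/-- Link a nameless object with the starts of all the trajectories in `δ`. -/
def applyCompl {T : 𝕋} (δ : Compl T) (P : NObj 𝕋) : NCfg 𝕋 :=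
  ((δ.entries.map (fun e => e.2.2.start.inst e.2.1)).sum, P)

end Complementary

end TimedILLST

/-!
The proof constructs, by induction on typing, the trajectory of a term that is linked with a
complementary configuration `δ`. Two constructions serve all typing rules.

* A term that provides its communication at a time constrained by `t.p` waits inertly while the
  trajectories in `δ` run in parallel (`exists_provider_of_valueInterp`). If the exchange occurs at
  time `t`, what remains of `δ` is its suffix at `t`, again a complementary configuration, to which
  the inductive hypothesis at time `t` applies.
* A term that cuts, forwards or communicates over a channel of its context waits until a given time
  `T'`, then makes silent steps, and continues as the trajectory that the inductive hypothesis
  provides at time `T'` (`exists_provider_of_steps`). The client interpretation of the channel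
  concerned supplies the other half of the communication. In a cut the new channel is provided by
  the trajectory of the first term, which retyping turns from a provided into a used one
  (`RetypeL.sound`); forwarding uses the converse passage (`RetypeR.sound`).

Trajectories are handled through `Evolves`, the mere existence of a multistepping that realizes
given states. Evolutions can be cut off at the start (`Evolves.suffix`), spliced
(`Evolves.trans`) and interleaved (`Evolves.add`); interleaving splices, at each passage of time in
one component, the other component run up to that time. Configurations have no freshness
conditions, so names of new channels are arbitrary.

On the syntactic side, a substitution followed by another one with a disjoint domain is a single
substitution (`Term.subst_subst`), and a typed term only depends on the substitution of the
variables in its context (`HasType.subst_congr`), so that `δ` can be split along with the context.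
-/

namespace TimedILLST

/-! ### Lookups in finite maps -/

section FiniteMaps

variable {X Y : Type*}

namespace FMap

theorem lookup_mapVal (f : X → Y) (m : FMap X) (x : Var) :
    (mapVal f m).lookup x = (m.lookup x).map f := by
  ext b
  have h := @Finmap.mem_lookup_iff _ (fun _ : Var => Y) _ (mapVal f m) x b
  simp only [Option.mem_def] at h
  rw [h, Option.map_eq_some_iff]
  simp only [mapVal, Multiset.mem_map, Sigma.map, id]
  constructor
  · rintro ⟨⟨k, a⟩, ha, hk⟩
    cases hk
    exact ⟨a, Finmap.mem_lookup_iff.2 ha, rfl⟩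
  · rintro ⟨a, ha, rfl⟩
    exact ⟨⟨x, a⟩, Finmap.mem_lookup_iff.1 ha, rfl⟩

theorem mem_mapVal (f : X → Y) (m : FMap X) (x : Var) : x ∈ mapVal f m ↔ x ∈ m := by
  rw [← Finmap.lookup_isSome, ← Finmap.lookup_isSome, lookup_mapVal, Option.isSome_map]

theorem lookup_insert_ite (m : FMap X) (x y : Var) (b : X) :
    (m.insert x b).lookup y = if y = x then some b else m.lookup y := by
  split_ifs with h
  · subst h; exact Finmap.lookup_insert m
  · exact Finmap.lookup_insert_of_ne m h

theorem lookup_erase_ite (m : FMap X) (x y : Var) :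
    (m.erase x).lookup y = if y = x then none else m.lookup y := by
  split_ifs with h
  · subst h; exact Finmap.lookup_erase y m
  · exact Finmap.lookup_erase_ne h

theorem lookup_singleton_ite (x y : Var) (b : X) :
    (Finmap.singleton x b : FMap X).lookup y = if y = x then some b else none := by
  split_ifs with h
  · subst h; exact Finmap.lookup_singleton_eq
  · rw [Finmap.lookup_eq_none, Finmap.mem_singleton]; exact h

theorem lookup_union (m m' : FMap X) (y : Var) :
    (m ∪ m').lookup y = (m.lookup y).or (m'.lookup y) := by
  by_cases h : y ∈ m
  · rw [Finmap.lookup_union_left h]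
    obtain ⟨b, hb⟩ := Finmap.mem_iff.1 h
    simp [hb]
  · rw [Finmap.lookup_union_right h, Finmap.lookup_eq_none.2 h, Option.none_or]

theorem insert_erase_of_lookup {m : FMap X} {x : Var} {b : X} (h : m.lookup x = some b) :
    (m.erase x).insert x b = m := by
  refine Finmap.ext_lookup fun y => ?_
  rw [lookup_insert_ite, lookup_erase_ite]
  split_ifs with hy
  · rw [hy, h]
  · rfl

theorem mapVal_insert (f : X → Y) (m : FMap X) (x : Var) (b : X) :
    mapVal f (m.insert x b) = (mapVal f m).insert x (f b) := by
  refine Finmap.ext_lookup fun y => ?_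
  rw [lookup_mapVal, lookup_insert_ite, lookup_insert_ite, lookup_mapVal]
  split_ifs <;> rfl

theorem mapVal_singleton (f : X → Y) (x : Var) (b : X) :
    mapVal f (Finmap.singleton x b) = Finmap.singleton x (f b) := by
  refine Finmap.ext_lookup fun y => ?_
  rw [lookup_mapVal, lookup_singleton_ite, lookup_singleton_ite]
  split_ifs <;> rfl

theorem mapVal_union (f : X → Y) (m m' : FMap X) :
    mapVal f (m ∪ m') = mapVal f m ∪ mapVal f m' := by
  refine Finmap.ext_lookup fun y => ?_
  rw [lookup_mapVal, lookup_union, lookup_union, lookup_mapVal, lookup_mapVal, Option.map_or]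

theorem mapVal_mapVal {Z : Type*} (f : Y → Z) (f' : X → Y) (m : FMap X) :
    mapVal f (mapVal f' m) = mapVal (f ∘ f') m := by
  refine Finmap.ext_lookup fun y => ?_
  rw [lookup_mapVal, lookup_mapVal, lookup_mapVal, Option.map_map]

/-- The restriction of a finite map to the keys that satisfy `K`. -/
def restrict (K : Var → Prop) [DecidablePred K] (m : FMap X) : FMap X where
  entries := m.entries.filter fun e => K e.1
  nodupKeys := by
    rw [← Multiset.nodup_keys]
    exact Multiset.nodup_of_le (Multiset.map_le_map (Multiset.filter_le _ _))
      (Multiset.nodup_keys.2 m.nodupKeys)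

theorem lookup_restrict (K : Var → Prop) [DecidablePred K] (m : FMap X) (x : Var) :
    (restrict K m).lookup x = if K x then m.lookup x else none := by
  ext b
  have h := @Finmap.mem_lookup_iff _ (fun _ : Var => X) _ (restrict K m) x b
  have h' := @Finmap.mem_lookup_iff _ (fun _ : Var => X) _ m x b
  simp only [Option.mem_def] at h h'
  rw [h]
  simp only [restrict, Multiset.mem_filter]
  rw [← h']
  split_ifs with hx <;> simp [hx]

end FMap

end FiniteMaps

/-! ### Substitution -/

section Substitution

variable {𝕋 : Type u}

theorem Subst.sym_insert (σ : Subst) (x : Var) (b : Label) :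
    Subst.sym (σ.insert x b) (.var x) = .chan b := by
  simp only [Subst.sym, Finmap.lookup_insert]

/-- Consecutive substitutions with disjoint domains amount to a single one. -/
theorem Term.subst_subst (M : Term 𝕋) : ∀ σ τ υ : Subst,
    (∀ x, σ.lookup x = none ∨ τ.lookup x = none) →
    (∀ x, υ.lookup x = (σ.lookup x).or (τ.lookup x)) →
    (M.subst σ).subst τ = M.subst υ := by
  have hsym : ∀ (s : Sym) (σ τ υ : Subst), (∀ x, υ.lookup x = (σ.lookup x).or (τ.lookup x)) →
      τ.sym (σ.sym s) = υ.sym s := by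
    rintro (a | x) σ τ υ hυ
    · rfl
    · simp only [Subst.sym, hυ x]
      cases h : σ.lookup x <;> simp
  have herase : ∀ (x : Var) (σ τ : Subst), (∀ y, σ.lookup y = none ∨ τ.lookup y = none) →
      ∀ y, (σ.erase x).lookup y = none ∨ (τ.erase x).lookup y = none := by
    intro x σ τ h y
    simp only [FMap.lookup_erase_ite]
    split_ifs
    · exact .inl rfl
    · exact h y
  have herase' : ∀ (x : Var) (σ τ υ : Subst),
      (∀ y, υ.lookup y = (σ.lookup y).or (τ.lookup y)) →
      ∀ y, (υ.erase x).lookup y = ((σ.erase x).lookup y).or ((τ.erase x).lookup y) := by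
    intro x σ τ υ h y
    simp only [FMap.lookup_erase_ite]
    split_ifs
    · rfl
    · exact h y
  induction M with
  | fwd T s => intro σ τ υ _ hυ; simp only [Term.subst, hsym s σ τ υ hυ]
  | cut T x A M₁ M₂ ih₁ ih₂ =>
    intro σ τ υ hd hυ
    simp only [Term.subst, ih₁ σ τ υ hd hυ,
      ih₂ _ _ _ (herase x σ τ hd) (herase' x σ τ υ hυ)]
  | oneR p => intro σ τ υ _ _; rfl
  | oneL T s M ih =>
    intro σ τ υ hd hυ
    simp only [Term.subst, hsym s σ τ υ hυ]
    congr 1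
    obtain a | x := s
    · exact ih _ _ _ hd hυ
    · -- If `σ` names `x`, the second substitution meets a name instead of `x` and removes
      -- nothing; but then `x` is not in its domain.
      cases hx : σ.lookup x with
      | none =>
        simp only [Subst.sym, hx, Subst.remove]
        exact ih _ _ _ (herase x σ τ hd) (herase' x σ τ υ hυ)
      | some b =>
        have hτ : τ.lookup x = none := by simpa [hx] using hd x
        simp only [Subst.sym, hx, Subst.remove]
        refine ih _ _ _ (fun y => ?_) (fun y => ?_)
        · rw [FMap.lookup_erase_ite]
          split_ifs
          · exact .inl rfl
          · exact hd y
        · rw [FMap.lookup_erase_ite, FMap.lookup_erase_ite]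
          split_ifs with hy
          · rw [hy, hτ]; rfl
          · exact hυ y
  | lolliR p x M ih =>
    intro σ τ υ hd hυ
    simp only [Term.subst, ih _ _ _ _ (herase x σ τ hd) (herase' x σ τ υ hυ)]
  | lolliL T s M₁ M₂ ih₁ ih₂ =>
    intro σ τ υ hd hυ
    simp only [Term.subst, hsym s σ τ υ hυ, ih₁ _ _ _ hd hυ, ih₂ _ _ _ hd hυ]
  | tensorR p M₁ M₂ ih₁ ih₂ =>
    intro σ τ υ hd hυ
    simp only [Term.subst, ih₁ _ _ _ _ hd hυ, ih₂ _ _ _ _ hd hυ]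
  | tensorL T s y M ih =>
    intro σ τ υ hd hυ
    simp only [Term.subst, hsym s σ τ υ hυ, ih _ _ _ (herase y σ τ hd) (herase' y σ τ υ hυ)]
  | withR p M₁ M₂ ih₁ ih₂ =>
    intro σ τ υ hd hυ
    simp only [Term.subst, ih₁ _ _ _ _ hd hυ, ih₂ _ _ _ _ hd hυ]
  | withL T s i M ih =>
    intro σ τ υ hd hυ
    simp only [Term.subst, hsym s σ τ υ hυ, ih _ _ _ hd hυ]
  | plusR p i M ih =>
    intro σ τ υ hd hυ
    simp only [Term.subst, ih _ _ _ _ hd hυ]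
  | plusL T s M₁ M₂ ih₁ ih₂ =>
    intro σ τ υ hd hυ
    simp only [Term.subst, hsym s σ τ υ hυ, ih₁ _ _ _ hd hυ, ih₂ _ _ _ hd hυ]

theorem Term.subst₁_subst_erase (M : Term 𝕋) (σ : Subst) (x : Var) (b : Label) :
    (M.subst (σ.erase x)).subst₁ b x = M.subst (σ.insert x b) := by
  refine M.subst_subst _ _ _ (fun y => ?_) (fun y => ?_)
  · rw [FMap.lookup_erase_ite, FMap.lookup_singleton_ite]
    split_ifs <;> simp
  · rw [FMap.lookup_insert_ite, FMap.lookup_erase_ite, FMap.lookup_singleton_ite]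
    split_ifs <;> simp

/-- The free variables of a typed term belong to its context. -/
theorem HasType.subst_congr [LinearOrder 𝕋] {n : ℕ} {F : PropCtx 𝕋 n} {Γ : Ctx 𝕋 n}
    {M : Open 𝕋 n (Term 𝕋)} {T : Open 𝕋 n 𝕋} {A : Open 𝕋 n (Ty 𝕋)} (hM : HasType F Γ M T A) :
    ∀ (g : TimeEnv 𝕋 n) (σ τ : Subst), (∀ x ∈ Γ, σ.lookup x = τ.lookup x) →
      (M g).subst σ = (M g).subst τ := by
  have hsym : ∀ (x : Var) (σ τ : Subst), σ.lookup x = τ.lookup x →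
      σ.sym (.var x) = τ.sym (.var x) := by
    intro x σ τ h
    simp only [Subst.sym, h]
  have herase : ∀ (x y : Var) (σ τ : Subst), (y ≠ x → σ.lookup y = τ.lookup y) →
      (σ.erase x).lookup y = (τ.erase x).lookup y := by
    intro x y σ τ h
    rw [FMap.lookup_erase_ite, FMap.lookup_erase_ite]
    split_ifs with hyx
    · rfl
    · exact h hyx
  have hbind : ∀ {m : ℕ} (Δ : Ctx 𝕋 m) (x : Var) (B : Open 𝕋 m (Ty 𝕋)) (σ τ : Subst),
      (∀ y ∈ Δ, σ.lookup y = τ.lookup y) →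
      ∀ y ∈ Δ.insert x B, (σ.erase x).lookup y = (τ.erase x).lookup y :=
    fun Δ x B σ τ h y hy =>
      herase x y σ τ fun hyx => h y ((Finmap.mem_insert.1 hy).resolve_left hyx)
  have hwk : ∀ {m : ℕ} {Δ : Ctx 𝕋 m} {σ τ : Subst}, (∀ x ∈ Δ, σ.lookup x = τ.lookup x) →
      ∀ x ∈ Δ.wk, σ.lookup x = τ.lookup x :=
    fun h x hx => h x ((FMap.mem_mapVal _ _ _).1 hx)
  have hins : ∀ {m : ℕ} {Δ : Ctx 𝕋 m} {x : Var} {B B' : Open 𝕋 m (Ty 𝕋)} {σ τ : Subst},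
      (∀ y ∈ Δ.insert x B, σ.lookup y = τ.lookup y) →
      ∀ y ∈ Δ.insert x B', σ.lookup y = τ.lookup y :=
    fun h y hy => h y (Finmap.mem_insert.2 (Finmap.mem_insert.1 hy))
  have hhead : ∀ {m : ℕ} {Δ : Ctx 𝕋 m} {x : Var} {B : Open 𝕋 m (Ty 𝕋)},
      x ∈ Δ.insert x B := Finmap.mem_insert.2 (.inl rfl)
  have htail : ∀ {m : ℕ} {Δ : Ctx 𝕋 m} {x y : Var} {B : Open 𝕋 m (Ty 𝕋)},
      y ∈ Δ → y ∈ Δ.insert x B := fun h => Finmap.mem_insert.2 (.inr h)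
  induction hM with
  | cut _ _ _ _ _ ih₁ ih₂ =>
    intro g σ τ h
    simp only [Term.subst]
    rw [ih₁ g σ τ fun x hx => h x (Finmap.mem_union.2 (.inl hx)),
      ih₂ g _ _ (hbind _ _ _ σ τ fun x hx => h x (Finmap.mem_union.2 (.inr hx)))]
  | fwd _ =>
    intro g σ τ h
    simp only [Term.subst]
    rw [hsym _ σ τ (h _ ((Finmap.mem_singleton _ _ _).2 rfl))]
  | oneR _ => intro g σ τ _; rfl
  | oneL _ _ _ _ ih =>
    intro g σ τ h
    simp only [Term.subst]
    rw [hsym _ σ τ (h _ hhead), Subst.remove, Subst.remove,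
      ih g _ _ fun y hy => herase _ y σ τ fun _ => h y (htail hy)]
  | lolliR _ _ _ ih =>
    intro g σ τ h
    simp only [Term.subst, Open.bind]
    congr 1
    funext t
    exact ih _ _ _ (hbind _ _ _ σ τ (hwk h))
  | lolliL _ _ _ _ _ _ _ ih₁ ih₂ =>
    intro g σ τ h
    simp only [Term.subst]
    rw [hsym _ σ τ (h _ hhead),
      ih₁ g σ τ fun y hy => h y (htail (Finmap.mem_union.2 (.inl hy))),
      ih₂ g σ τ fun y hy => h y ((Finmap.mem_insert.1 hy).elim (fun e => e ▸ hhead)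
        fun hy => htail (Finmap.mem_union.2 (.inr hy)))]
  | tensorR _ _ _ _ ih₁ ih₂ =>
    intro g σ τ h
    simp only [Term.subst, Open.bind]
    congr 1 <;> funext t
    · exact ih₁ _ _ _ (hwk fun y hy => h y (Finmap.mem_union.2 (.inl hy)))
    · exact ih₂ _ _ _ (hwk fun y hy => h y (Finmap.mem_union.2 (.inr hy)))
  | tensorL _ _ _ _ _ _ ih =>
    intro g σ τ h
    simp only [Term.subst]
    rw [hsym _ σ τ (h _ hhead), ih g _ _ (hbind _ _ _ σ τ (hins h))]
  | withR _ _ _ ih₁ ih₂ =>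
    intro g σ τ h
    simp only [Term.subst, Open.bind]
    congr 1 <;> funext t
    · exact ih₁ _ _ _ (hwk h)
    · exact ih₂ _ _ _ (hwk h)
  | withL i _ _ _ _ ih =>
    intro g σ τ h
    simp only [Term.subst]
    rw [hsym _ σ τ (h _ hhead), ih g _ _ (hins h)]
  | plusR i _ _ ih =>
    intro g σ τ h
    simp only [Term.subst, Open.bind]
    congr 1
    funext t
    exact ih _ _ _ (hwk h)
  | plusL _ _ _ _ _ ih₁ ih₂ =>
    intro g σ τ h
    simp only [Term.subst]
    rw [hsym _ σ τ (h _ hhead), ih₁ g _ _ (hins h), ih₂ g _ _ (hins h)]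

end Substitution

/-! ### Evolutions of configurations -/

section Evolution

variable {𝕋 : Type u} [LinearOrder 𝕋]

/-- `Evolves T Ω f Ω'` says that some multistepping from `Ω` at time `T` to `Ω'` realizes the
restriction of `f` to `[T, ∞)`. The trajectory is a function on all times, of which the values
before `T` are irrelevant, so that it need not be transported when `T` changes. -/
inductive Evolves : 𝕋 → Cfg 𝕋 → (𝕋 → Cfg 𝕋) → Cfg 𝕋 → Prop
  | refl {T : 𝕋} {Ω : Cfg 𝕋} {f : 𝕋 → Cfg 𝕋} : (∀ t, T ≤ t → f t = Ω) → Evolves T Ω f Ω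
  | stepT {T₁ T₂ : 𝕋} {Ω Ω' : Cfg 𝕋} {f : 𝕋 → Cfg 𝕋} : T₁ ≤ T₂ →
      (∀ t, T₁ ≤ t → t < T₂ → f t = Ω) → Evolves T₂ Ω f Ω' → Evolves T₁ Ω f Ω'
  | stepC {T : 𝕋} {Ω Ω' Ω'' : Cfg 𝕋} {f : 𝕋 → Cfg 𝕋} : Step Ω .eps T Ω' →
      Evolves T Ω' f Ω'' → Evolves T Ω f Ω''

theorem Evolves.exists_realizes {T : 𝕋} {Ω Ω' : Cfg 𝕋} {f : 𝕋 → Cfg 𝕋} (h : Evolves T Ω f Ω') :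
    ∃ (T' : 𝕋) (σ : MultiStep Ω T Ω' T'), Realizes (fun t => f t.1) σ := by
  induction h with
  | @refl T Ω f hf =>
    refine ⟨_, .refl Ω T, ?_⟩
    have : (fun t : Set.Ici T => f t.1) = fun _ => Ω := funext fun t => hf t.1 t.2
    rw [this]
    exact .refl _ _
  | @stepT T₁ T₂ Ω Ω' f hT hf _ ih =>
    obtain ⟨T', σ, hσ⟩ := ih
    refine ⟨T', .stepT hT σ, ?_⟩
    have : (fun t : Set.Ici T₁ => f t.1) = Traj.extend Ω T₁ fun t : Set.Ici T₂ => f t.1 := by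
      funext t
      unfold Traj.extend
      split_ifs with h
      · rfl
      · exact hf t.1 t.2 (not_le.1 h)
    rw [this]
    exact .stepT hT hσ
  | stepC hs _ ih =>
    obtain ⟨T', σ, hσ⟩ := ih
    exact ⟨T', .stepC hs σ, .stepC hs hσ⟩

theorem Realizes.evolves {T T' : 𝕋} {Ω Ω' : Cfg 𝕋} {s : Traj (Cfg 𝕋) T}
    {σ : MultiStep Ω T Ω' T'} (h : Realizes s σ) :
    ∀ f : 𝕋 → Cfg 𝕋, (∀ t : Set.Ici T, f t.1 = s t) → Evolves T Ω f Ω' := by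
  induction h with
  | refl Ω T => exact fun f hf => .refl fun t ht => hf ⟨t, ht⟩
  | stepT hT _ ih =>
    intro f hf
    refine .stepT hT (fun t h₁ h₂ => ?_) (ih f fun t => ?_)
    · rw [hf ⟨t, h₁⟩, Traj.extend, dif_neg (not_le.2 h₂)]
    · rw [hf ⟨t.1, hT.trans t.2⟩, Traj.extend, dif_pos (show _ ≤ _ from t.2)]
  | stepC hs _ ih => exact fun f hf => .stepC hs (ih f hf)

namespace Evolves

variable {T T₂ : 𝕋} {Ω Ω' Ω'' Ω₁ Ω₁' Ω₂ Ω₂' : Cfg 𝕋} {f f' f₁ f₂ : 𝕋 → Cfg 𝕋}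

theorem congr (h : Evolves T Ω f Ω') (hf : ∀ t, T ≤ t → f t = f' t) : Evolves T Ω f' Ω' := by
  induction h with
  | refl h => exact .refl fun t ht => (hf t ht).symm.trans (h t ht)
  | stepT hT h _ ih =>
    exact .stepT hT (fun t h₁ h₂ => (hf t h₁).symm.trans (h t h₁ h₂))
      (ih fun t ht => hf t (hT.trans ht))
  | stepC hs _ ih => exact .stepC hs (ih hf)

theorem suffix (h : Evolves T Ω f Ω') (hT : T ≤ T₂) : Evolves T₂ (f T₂) f Ω' := by
  induction h with
  | refl h =>
    rw [h _ hT]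
    exact .refl fun t ht => h t (hT.trans ht)
  | @stepT T₁ T₃ _ _ _ h₁₃ h hev ih =>
    obtain h₃ | h₃ := le_or_gt T₃ T₂
    · exact ih h₃
    · rw [h _ hT h₃]
      exact .stepT h₃.le (fun t h₁ h₂ => h t (hT.trans h₁) h₂) hev
  | stepC _ _ ih => exact ih hT

/-- Follow an evolution up to the time `T₂`, and another one from then on. -/
theorem trans (h : Evolves T Ω f Ω') (hT : T ≤ T₂) (h' : Evolves T₂ (f T₂) f' Ω'')
    (hf : ∀ t, T ≤ t → t < T₂ → f t = f' t) : Evolves T Ω f' Ω'' := by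
  induction h with
  | refl h =>
    rw [h _ hT] at h'
    exact .stepT hT (fun t h₁ h₂ => (hf t h₁ h₂).symm.trans (h t h₁)) h'
  | @stepT T₁ T₃ _ _ _ h₁₃ h hev ih =>
    obtain h₃ | h₃ := le_or_gt T₃ T₂
    · exact .stepT h₁₃ (fun t h₁ h₂ => (hf t h₁ (h₂.trans_le h₃)).symm.trans (h t h₁ h₂))
        (ih h₃ h' fun t h₁ h₂ => hf t (h₁₃.trans h₁) h₂)
    · rw [h _ hT h₃] at h'
      exact .stepT hT (fun t h₁ h₂ => (hf t h₁ h₂).symm.trans (h t h₁ (h₂.trans h₃))) h'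
  | stepC hs _ ih => exact .stepC hs (ih hT h' hf)

theorem frame (h : Evolves T Ω f Ω') (Ω₀ : Cfg 𝕋) :
    Evolves T (Ω + Ω₀) (fun t => f t + Ω₀) (Ω' + Ω₀) := by
  induction h with
  | refl h => exact .refl fun t ht => by rw [h t ht]
  | stepT hT h _ ih => exact .stepT hT (fun t h₁ h₂ => by rw [h t h₁ h₂]) ih
  | stepC hs _ ih => exact .stepC (.frame hs) ih

/-- Evolutions of the parts of a configuration interleave. -/
theorem add (h₁ : Evolves T Ω₁ f₁ Ω₁') : Evolves T Ω₂ f₂ Ω₂' →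
    Evolves T (Ω₁ + Ω₂) (fun t => f₁ t + f₂ t) (Ω₁' + Ω₂') := by
  induction h₁ generalizing Ω₂ with
  | @refl _ Ω f h =>
    intro h₂
    rw [add_comm Ω, add_comm Ω]
    exact (h₂.frame Ω).congr fun t ht => by rw [h t ht, add_comm]
  | @stepT T₁ T₃ Ω Ω' f hT h _ ih =>
    intro h₂
    rw [add_comm Ω]
    refine (h₂.frame Ω).trans hT ?_ fun t h₁ h₃ => by rw [h t h₁ h₃, add_comm]
    rw [add_comm _ Ω]
    exact ih (h₂.suffix hT)
  | stepC hs _ ih => exact fun h₂ => .stepC (.frame hs) (ih h₂)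

theorem of_steps (h : Relation.ReflTransGen (fun Ω Ω' => Step Ω .eps T Ω') Ω Ω')
    (h' : Evolves T Ω' f Ω'') : Evolves T Ω f Ω'' := by
  induction h using Relation.ReflTransGen.head_induction_on with
  | refl => exact h'
  | head hs _ ih => exact .stepC hs ih

end Evolves

end Evolution

/-! ### Trajectories -/

section Trajectories

variable {𝕋 : Type u} [LinearOrder 𝕋] {T T' : 𝕋}

namespace CompTraj

/-- The state at a time; before the start, it is the initial state by convention. -/
def stateAt (w : CompTraj T) (t : 𝕋) : NCfg 𝕋 := if h : T ≤ t then w.traj ⟨t, h⟩ else w.start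

theorem stateAt_of_le (w : CompTraj T) {t : 𝕋} (h : T ≤ t) : w.stateAt t = w.traj ⟨t, h⟩ :=
  dif_pos h

theorem evolves (w : CompTraj T) (a : Label) :
    Evolves T (w.start.inst a) (fun t => (w.stateAt t).inst a) (w.finish.inst a) :=
  (w.realize a).evolves _ fun t => by rw [w.stateAt_of_le t.2]

/-- The computable trajectory with given states, the multisteppings being chosen. -/
noncomputable def ofEvolves (start finish : NCfg 𝕋) (f : 𝕋 → NCfg 𝕋)
    (h : ∀ a, Evolves T (start.inst a) (fun t => (f t).inst a) (finish.inst a)) :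
    CompTraj T where
  start := start
  finish := finish
  traj t := f t.1
  stepTo a := (h a).exists_realizes.choose
  steps a := (h a).exists_realizes.choose_spec.choose
  realize a := (h a).exists_realizes.choose_spec.choose_spec

/-- The remainder of a trajectory from a later time on. -/
noncomputable def suffix (w : CompTraj T) (h : T ≤ T') : CompTraj T' :=
  ofEvolves (w.stateAt T') w.finish w.stateAt fun a => (w.evolves a).suffix h

end CompTraj

namespace Compl

/-- The configuration of the initial states. -/
def startCfg (δ : Compl T) : Cfg 𝕋 := (δ.entries.map fun e => e.2.2.start.inst e.2.1).sum

/-- The configuration of the states at a time. -/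
def cfgAt (δ : Compl T) (t : 𝕋) : Cfg 𝕋 :=
  (δ.entries.map fun e => (e.2.2.stateAt t).inst e.2.1).sum

/-- The configuration of the final states. -/
def finishCfg (δ : Compl T) : Cfg 𝕋 := (δ.entries.map fun e => e.2.2.finish.inst e.2.1).sum

/-- The trajectories run in parallel. -/
theorem evolves (δ : Compl T) : Evolves T δ.startCfg δ.cfgAt δ.finishCfg := by
  unfold startCfg cfgAt finishCfg
  induction δ.entries using Multiset.induction_on with
  | empty => exact .refl fun _ _ => by simp
  | cons e s ih =>
    simp only [Multiset.map_cons, Multiset.sum_cons]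
    exact (e.2.2.evolves e.2.1).add ih

theorem startCfg_insert {δ : Compl T} {x : Var} (hx : x ∉ δ) (b : Label) (w : CompTraj T) :
    startCfg (δ.insert x (b, w)) = w.start.inst b + startCfg δ := by
  simp only [startCfg, Finmap.entries_insert_of_notMem hx, Multiset.map_cons, Multiset.sum_cons]

theorem startCfg_eq_restrict_add (δ : Compl T) (K : Var → Prop) [DecidablePred K] :
    startCfg δ = startCfg (FMap.restrict K δ) + startCfg (FMap.restrict (fun x => ¬ K x) δ) := by
  simp only [startCfg, FMap.restrict]
  rw [← Multiset.sum_add, ← Multiset.map_add, Multiset.filter_add_not]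

/-- The remainders of all trajectories from a later time on. -/
noncomputable def suffix (δ : Compl T) (h : T ≤ T') : Compl T' :=
  FMap.mapVal (fun e => (e.1, e.2.suffix h)) δ

theorem startCfg_suffix (δ : Compl T) (h : T ≤ T') : (δ.suffix h).startCfg = δ.cfgAt T' := by
  simp only [startCfg, cfgAt, suffix, FMap.mapVal, Multiset.map_map]
  rfl

theorem lookup_substOf (δ : Compl T) (x : Var) :
    (substOf δ).lookup x = (δ.lookup x).map Prod.fst := FMap.lookup_mapVal _ _ _

theorem substOf_suffix (δ : Compl T) (h : T ≤ T') : substOf (δ.suffix h) = substOf δ := by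
  rw [substOf, suffix, FMap.mapVal_mapVal]
  rfl

theorem substOf_insert (δ : Compl T) (x : Var) (b : Label) (w : CompTraj T) :
    substOf (δ.insert x (b, w)) = (substOf δ).insert x b := FMap.mapVal_insert _ _ _ _

end Compl

end Trajectories

/-! ### The logical relation -/

section LogicalRelation

variable {𝕋 : Type u} [LinearOrder 𝕋] {T T' : 𝕋}

section ValueInterp

variable {p : 𝕋 → Prop} {A₁ A₂ : 𝕋 → Ty 𝕋} {d : Mode} {Ω : NCfg 𝕋}

theorem valueInterp_one :
    ValueInterp (.one p) d T Ω ↔ ∀ a : Label, Step (Ω.inst a) (.send a .close) T 0 := by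
  rw [ValueInterp]

theorem valueInterp_tensor : ValueInterp (.tensor p A₁ A₂) d T Ω ↔
    ∀ a : Label, ∃ (c : Label) (w₁ w₂ : CompTraj T),
      TermInterp (A₁ T) d T w₁ ∧ TermInterp (A₂ T) d T w₂ ∧
      Step (Ω.inst a) (.send a (.chan c)) T (w₁.start.inst c + w₂.start.inst a) := by
  rw [ValueInterp]; rfl

theorem valueInterp_lolli : ValueInterp (.lolli p A₁ A₂) d T Ω ↔
    ∀ (a : Label) (w₁ : CompTraj T), TermInterp (A₁ T) d.inv T w₁ →
      ∀ c : Label, ∃ (Ω₂ : NCfg 𝕋) (w₂ : CompTraj T), TermInterp (A₂ T) d T w₂ ∧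
        Step (Ω.inst a) (.recv a (.chan c)) T (Ω₂.inst a) ∧
        w₂.start = Ω₂.join (w₁.start.inst c) := by
  rw [ValueInterp]; rfl

theorem valueInterp_with : ValueInterp (.with p A₁ A₂) d T Ω ↔
    ∀ (i : Selector) (a : Label), ∃ w : CompTraj T, TermInterp (sel i A₁ A₂ T) d T w ∧
      Step (Ω.inst a) (.recv a (.selector i)) T (w.start.inst a) := by
  rw [ValueInterp, Bool.forall_bool]; rfl

theorem valueInterp_plus : ValueInterp (.plus p A₁ A₂) d T Ω ↔
    ∃ i : Selector, ∀ a : Label, ∃ w : CompTraj T, TermInterp (sel i A₁ A₂ T) d T w ∧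
      Step (Ω.inst a) (.send a (.selector i)) T (w.start.inst a) := by
  rw [ValueInterp, Bool.exists_bool]; rfl

variable {q : 𝕋 → Prop} {B₁ B₂ : 𝕋 → Ty 𝕋} {d' : Mode}

theorem ValueInterp.one_congr (h : ValueInterp (.one p) d T Ω) : ValueInterp (.one q) d' T Ω :=
  valueInterp_one.2 (valueInterp_one.1 h)

theorem ValueInterp.tensor_mono (h : ValueInterp (.tensor p A₁ A₂) d T Ω)
    (h₁ : ∀ w, TermInterp (A₁ T) d T w → TermInterp (B₁ T) d' T w)
    (h₂ : ∀ w, TermInterp (A₂ T) d T w → TermInterp (B₂ T) d' T w) :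
    ValueInterp (.tensor q B₁ B₂) d' T Ω := by
  rw [valueInterp_tensor] at h ⊢
  intro a
  obtain ⟨c, w₁, w₂, hw₁, hw₂, hs⟩ := h a
  exact ⟨c, w₁, w₂, h₁ _ hw₁, h₂ _ hw₂, hs⟩

theorem ValueInterp.lolli_mono (h : ValueInterp (.lolli p A₁ A₂) d T Ω)
    (h₁ : ∀ w, TermInterp (B₁ T) d'.inv T w → TermInterp (A₁ T) d.inv T w)
    (h₂ : ∀ w, TermInterp (A₂ T) d T w → TermInterp (B₂ T) d' T w) :
    ValueInterp (.lolli q B₁ B₂) d' T Ω := by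
  rw [valueInterp_lolli] at h ⊢
  intro a w₁ hw₁ c
  obtain ⟨Ω₂, w₂, hw₂, hs⟩ := h a w₁ (h₁ _ hw₁) c
  exact ⟨Ω₂, w₂, h₂ _ hw₂, hs⟩

theorem sel_mono (h₁ : ∀ w, TermInterp (A₁ T) d T w → TermInterp (B₁ T) d' T w)
    (h₂ : ∀ w, TermInterp (A₂ T) d T w → TermInterp (B₂ T) d' T w) (i : Selector) :
    ∀ w, TermInterp (sel i A₁ A₂ T) d T w → TermInterp (sel i B₁ B₂ T) d' T w := by
  cases i
  exacts [h₁, h₂]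

theorem ValueInterp.with_mono (h : ValueInterp (.with p A₁ A₂) d T Ω)
    (h₁ : ∀ w, TermInterp (A₁ T) d T w → TermInterp (B₁ T) d' T w)
    (h₂ : ∀ w, TermInterp (A₂ T) d T w → TermInterp (B₂ T) d' T w) :
    ValueInterp (.with q B₁ B₂) d' T Ω := by
  rw [valueInterp_with] at h ⊢
  intro i a
  obtain ⟨w, hw, hs⟩ := h i a
  exact ⟨w, sel_mono h₁ h₂ i w hw, hs⟩

theorem ValueInterp.plus_mono (h : ValueInterp (.plus p A₁ A₂) d T Ω)
    (h₁ : ∀ w, TermInterp (A₁ T) d T w → TermInterp (B₁ T) d' T w)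
    (h₂ : ∀ w, TermInterp (A₂ T) d T w → TermInterp (B₂ T) d' T w) :
    ValueInterp (.plus q B₁ B₂) d' T Ω := by
  rw [valueInterp_plus] at h ⊢
  obtain ⟨i, h⟩ := h
  refine ⟨i, fun a => ?_⟩
  obtain ⟨w, hw, hs⟩ := h a
  exact ⟨w, sel_mono h₁ h₂ i w hw, hs⟩

end ValueInterp

theorem TermInterp.valueInterp_suffix {A : Ty 𝕋} {w : CompTraj T} (hw : TermInterp A .client T w)
    (h : T ≤ T') (hp : A.prop T') : ValueInterp A .client T' (w.suffix h).start := by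
  have := hw T' h hp
  rwa [← w.stateAt_of_le h] at this

theorem TermInterp.suffix {A : Ty 𝕋} {w : CompTraj T} (hw : TermInterp A .client T w)
    (h : T ≤ T') : TermInterp A .client T' (w.suffix h) := by
  intro t ht hp
  have := hw t (h.trans ht) hp
  rwa [← w.stateAt_of_le (h.trans ht)] at this

/-- A root object that waits inertly while the trajectories of `δ` run. -/
theorem exists_provider_of_valueInterp (δ : Compl T) (P : NObj 𝕋) (B : Ty 𝕋)
    (h : ∀ t, B.prop t → ∃ hT : T ≤ t, ValueInterp B .provider t ((δ.suffix hT).startCfg, P)) :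
    ∃ w : CompTraj T, applyCompl δ P = w.start ∧ TermInterp B .provider T w := by
  refine ⟨.ofEvolves (δ.startCfg, P) (δ.finishCfg, P) (fun t => (δ.cfgAt t, P))
    fun a => δ.evolves.frame {Atomic.proc a P}, rfl, fun t ht => ?_⟩
  obtain ⟨hT, hv⟩ := h t ht
  rw [δ.startCfg_suffix] at hv
  exact ⟨hT, hv⟩

/-- A root object that waits until the time `T'`, when silent steps lead to the start of a given
trajectory. -/
theorem exists_provider_of_steps (δ : Compl T) (P : NObj 𝕋) (B : Ty 𝕋) (hT : T ≤ T')
    (h : ∃ w : CompTraj T', TermInterp B .provider T' w ∧ ∀ a,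
      Relation.ReflTransGen (fun Ω Ω' => Step Ω .eps T' Ω')
        ((δ.suffix hT).startCfg + {Atomic.proc a P}) (w.start.inst a)) :
    ∃ w : CompTraj T, applyCompl δ P = w.start ∧ TermInterp B .provider T w := by
  obtain ⟨w, hw, hs⟩ := h
  rw [δ.startCfg_suffix] at hs
  refine ⟨.ofEvolves (δ.startCfg, P) w.finish
    (fun t => if T' ≤ t then w.stateAt t else (δ.cfgAt t, P)) fun a => ?_, rfl, fun t ht => ?_⟩
  · refine (δ.evolves.frame {Atomic.proc a P}).trans hT (.of_steps (hs a) ?_) fun t _ ht => ?_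
    · exact (w.evolves a).congr fun t ht => by rw [if_pos ht]
    · rw [if_neg (not_le.2 ht)]; rfl
  · obtain ⟨h', hv⟩ := hw t ht
    refine ⟨hT.trans h', ?_⟩
    rw [← w.stateAt_of_le h'] at hv
    simpa only [CompTraj.ofEvolves, if_pos h'] using hv

end LogicalRelation

/-! ### Soundness of retyping -/

section Retyping

variable {𝕋 : Type u}

theorem PropCtx.Holds.ext {n : ℕ} {F : PropCtx 𝕋 n} {g : TimeEnv 𝕋 n} (h : F.Holds g)
    {p : Open 𝕋 (n + 1) Prop} {t : 𝕋} (hp : p.bind g t) : (F.ext p).Holds (g.ext t) := by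
  intro φ hφ
  obtain rfl | hφ := List.mem_cons.1 hφ
  · exact hp
  · obtain ⟨ψ, hψ, rfl⟩ := List.mem_map.1 hφ
    exact h ψ hψ

variable [LinearOrder 𝕋]

theorem PropCtx.Holds.extLe {n : ℕ} {F : PropCtx 𝕋 n} {g : TimeEnv 𝕋 n} (h : F.Holds g)
    {T : Open 𝕋 n 𝕋} {q : Open 𝕋 (n + 1) Prop} {t : 𝕋} (hT : T g ≤ t) (hq : q.bind g t) :
    (F.extLe T q).Holds (g.ext t) := by
  intro φ hφ
  obtain rfl | hφ := List.mem_cons.1 hφ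
  · exact hq
  · exact h.ext (p := leProp T.wk TimeEnv.new) hT φ hφ

/-- Values are monotone in their components, and the premises on `t.p` and `t.q` make every time at
which a provider of `B` must be ready a time at which the client of `A` may interact. -/
theorem RetypeR.sound {n : ℕ} {F : PropCtx 𝕋 n} {A B : Open 𝕋 n (Ty 𝕋)} {T : Open 𝕋 n 𝕋}
    (h : RetypeR F A B T) : ∀ g : TimeEnv 𝕋 n, F.Holds g → ∀ w : CompTraj (T g),
      TermInterp (A g) .client (T g) w → TermInterp (B g) .provider (T g) w := by
  induction h with
  | one hp hT =>
    intro g hg w hw t hq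
    have hF := hg.ext hq
    exact ⟨hT _ hF, (hw t (hT _ hF) (hp _ hF)).one_congr⟩
  | lolli hp hT _ _ ih₁ ih₂ =>
    intro g hg w hw t hq
    have hF := hg.ext hq
    exact ⟨hT _ hF, (hw t (hT _ hF) (hp _ hF)).lolli_mono (ih₁ _ hF) (ih₂ _ hF)⟩
  | tensor hp hT _ _ ih₁ ih₂ =>
    intro g hg w hw t hq
    have hF := hg.ext hq
    exact ⟨hT _ hF, (hw t (hT _ hF) (hp _ hF)).tensor_mono (ih₁ _ hF) (ih₂ _ hF)⟩
  | plus hp hT _ _ ih₁ ih₂ =>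
    intro g hg w hw t hq
    have hF := hg.ext hq
    exact ⟨hT _ hF, (hw t (hT _ hF) (hp _ hF)).plus_mono (ih₁ _ hF) (ih₂ _ hF)⟩
  -- The remaining connective is `&`, whose constructor name is a keyword.
  | _ hp hT _ _ ih₁ ih₂ =>
    intro g hg w hw t hq
    have hF := hg.ext hq
    exact ⟨hT _ hF, (hw t (hT _ hF) (hp _ hF)).with_mono (ih₁ _ hF) (ih₂ _ hF)⟩

/-- The hypothesis `T ≤ t` in the premises is available because a client interacts at or after `T`
only. -/
theorem RetypeL.sound {n : ℕ} {F : PropCtx 𝕋 n} {A B : Open 𝕋 n (Ty 𝕋)} {T : Open 𝕋 n 𝕋}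
    (h : RetypeL F A B T) : ∀ g : TimeEnv 𝕋 n, F.Holds g → ∀ w : CompTraj (T g),
      TermInterp (A g) .provider (T g) w → TermInterp (B g) .client (T g) w := by
  induction h with
  | one hp =>
    intro g hg w hw t ht hq
    obtain ⟨_, hv⟩ := hw t (hp _ (hg.extLe ht hq))
    exact hv.one_congr
  | lolli hp _ _ ih₁ ih₂ =>
    intro g hg w hw t ht hq
    have hF := hg.extLe ht hq
    obtain ⟨_, hv⟩ := hw t (hp _ hF)
    exact hv.lolli_mono (ih₁ _ hF) (ih₂ _ hF)
  | tensor hp _ _ ih₁ ih₂ =>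
    intro g hg w hw t ht hq
    have hF := hg.extLe ht hq
    obtain ⟨_, hv⟩ := hw t (hp _ hF)
    exact hv.tensor_mono (ih₁ _ hF) (ih₂ _ hF)
  | plus hp _ _ ih₁ ih₂ =>
    intro g hg w hw t ht hq
    have hF := hg.extLe ht hq
    obtain ⟨_, hv⟩ := hw t (hp _ hF)
    exact hv.plus_mono (ih₁ _ hF) (ih₂ _ hF)
  -- The remaining connective is `&`, whose constructor name is a keyword.
  | _ hp _ _ ih₁ ih₂ =>
    intro g hg w hw t ht hq
    have hF := hg.extLe ht hq
    obtain ⟨_, hv⟩ := hw t (hp _ hF)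
    exact hv.with_mono (ih₁ _ hF) (ih₂ _ hF)

end Retyping

/-! ### Complementary configurations -/

section Complementary

variable {𝕋 : Type u}

namespace Ctx

variable {n : ℕ} (Γ Γ' : Ctx 𝕋 n) (g : TimeEnv 𝕋 n)

theorem inst_insert (x : Var) (A : Open 𝕋 n (Ty 𝕋)) :
    Ctx.inst (Γ.insert x A) g = (Γ.inst g).insert x (A g) := FMap.mapVal_insert _ _ _ _

theorem inst_union : Ctx.inst (Γ ∪ Γ') g = Γ.inst g ∪ Γ'.inst g := FMap.mapVal_union _ _ _

theorem inst_wk (t : 𝕋) : Γ.wk.inst (g.ext t) = Γ.inst g := FMap.mapVal_mapVal _ _ _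

theorem mem_inst (x : Var) : x ∈ Γ.inst g ↔ x ∈ Γ := FMap.mem_mapVal _ _ _

end Ctx

namespace TypedCompl

variable [LinearOrder 𝕋] {T T' : 𝕋} {Γ Γ₁ Γ₂ : FMap (Ty 𝕋)} {δ δ₁ δ₂ : Compl T} {x : Var} {A : Ty 𝕋}

theorem mem_iff (h : TypedCompl T Γ δ) (x : Var) : x ∈ δ ↔ x ∈ Γ := by
  rw [← Finmap.lookup_isSome, ← Finmap.lookup_isSome]
  have hx := h x
  revert hx
  generalize δ.lookup x = o
  generalize Γ.lookup x = o'
  rintro (_ | _) <;> simp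

theorem suffix (h : TypedCompl T Γ δ) (hT : T ≤ T') : TypedCompl T' Γ (δ.suffix hT) := by
  intro x
  rw [Compl.suffix, FMap.lookup_mapVal]
  have hx := h x
  revert hx
  generalize δ.lookup x = o
  generalize Γ.lookup x = o'
  rintro (hw | _)
  exacts [.some (hw.suffix hT), .none]

theorem insert (h : TypedCompl T Γ δ) {w : CompTraj T} (hw : TermInterp A .client T w)
    (b : Label) : TypedCompl T (Γ.insert x A) (δ.insert x (b, w)) := by
  intro y
  rw [FMap.lookup_insert_ite, FMap.lookup_insert_ite]
  split_ifs
  exacts [.some hw, h y]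

theorem exists_of_insert (h : TypedCompl T (Γ.insert x A) δ) (hx : x ∉ Γ) :
    ∃ (b : Label) (w : CompTraj T) (δ₀ : Compl T), δ = δ₀.insert x (b, w) ∧
      TypedCompl T Γ δ₀ ∧ TermInterp A .client T w := by
  have hx' := h x
  rw [FMap.lookup_insert_ite, if_pos rfl] at hx'
  generalize ho : δ.lookup x = o at hx'
  obtain @⟨⟨b, w⟩, _, hw⟩ := hx'
  refine ⟨b, w, δ.erase x, (FMap.insert_erase_of_lookup ho).symm, fun y => ?_, hw⟩
  have hy := h y
  rw [FMap.lookup_insert_ite] at hy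
  rw [FMap.lookup_erase_ite]
  split_ifs at hy ⊢ with hyx
  · rw [hyx, Finmap.lookup_eq_none.2 hx]
    exact .none
  · exact hy

theorem exists_of_union (h : TypedCompl T (Γ₁ ∪ Γ₂) δ) (hd : Γ₁.Disjoint Γ₂) :
    ∃ δ₁ δ₂ : Compl T, TypedCompl T Γ₁ δ₁ ∧ TypedCompl T Γ₂ δ₂ ∧
      δ.startCfg = δ₁.startCfg + δ₂.startCfg ∧
      (∀ x ∈ Γ₁, (substOf δ).lookup x = (substOf δ₁).lookup x) ∧
      ∀ x ∈ Γ₂, (substOf δ).lookup x = (substOf δ₂).lookup x := by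
  refine ⟨FMap.restrict (· ∈ Γ₁) δ, FMap.restrict (· ∉ Γ₁) δ, fun x => ?_, fun x => ?_,
    δ.startCfg_eq_restrict_add _, fun x hx => ?_, fun x hx => ?_⟩
  · rw [FMap.lookup_restrict]
    split_ifs with hx
    · have := h x
      rwa [Finmap.lookup_union_left hx] at this
    · rw [Finmap.lookup_eq_none.2 hx]
      exact .none
  · rw [FMap.lookup_restrict]
    split_ifs with hx
    · rw [Finmap.lookup_eq_none.2 (hd x hx)]
      exact .none
    · have := h x
      rwa [Finmap.lookup_union_right hx] at this
  · rw [Compl.lookup_substOf, Compl.lookup_substOf, FMap.lookup_restrict, if_pos hx]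
  · rw [Compl.lookup_substOf, Compl.lookup_substOf, FMap.lookup_restrict,
      if_pos fun hx' => hd x hx' hx]

end TypedCompl

end Complementary

/-! ### The fundamental theorem -/

section Fundamental

variable {𝕋 : Type u}

/-- The configuration of the single term `M` named `a`. -/
def Term.named (M : Term 𝕋) (a : Label) : Cfg 𝕋 := {Atomic.proc a ⟨illst 𝕋, M⟩}

theorem Step.congr {Ω₁ Ω₁' Ω₂ Ω₂' : Cfg 𝕋} {α : Action} {T : 𝕋} (h : Step Ω₁ α T Ω₁')
    (h₁ : Ω₂ = Ω₁) (h₂ : Ω₂' = Ω₁') : Step Ω₂ α T Ω₂' := by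
  rwa [h₁, h₂]

theorem TermStep.step_singleton {M M' : Term 𝕋} {a b : Label} {α : Action} {T : 𝕋}
    (h : TermStep M a α T {Atomic.proc b M'}) : Step (M.named a) α T (M'.named b) :=
  .obj (S := illst 𝕋) h

theorem TermStep.step_pair {M M₁ M₂ : Term 𝕋} {a b₁ b₂ : Label} {α : Action} {T : 𝕋}
    (h : TermStep M a α T {Atomic.proc b₁ M₁, Atomic.proc b₂ M₂}) :
    Step (M.named a) α T (M₁.named b₁ + M₂.named b₂) :=
  .obj (S := illst 𝕋) h

variable [LinearOrder 𝕋] {T T' : 𝕋}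

theorem Compl.startCfg_suffix_insert {δ : Compl T} {Γ : FMap (Ty 𝕋)} (hδ : TypedCompl T Γ δ)
    {x : Var} (hx : x ∉ Γ) (b : Label) (w : CompTraj T) (h : T ≤ T') :
    Compl.startCfg (Compl.suffix (δ.insert x (b, w)) h) =
      (w.suffix h).start.inst b + (δ.suffix h).startCfg := by
  rw [Compl.suffix, FMap.mapVal_insert]
  exact Compl.startCfg_insert (fun hx' => hx (((hδ.suffix h).mem_iff x).1 hx')) _ _

/-- The conclusion of the fundamental theorem for a closed instance. -/
def Sound (T : 𝕋) (Γ : FMap (Ty 𝕋)) (M : Term 𝕋) (A : Ty 𝕋) : Prop :=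
  ∀ δ : Compl T, TypedCompl T Γ δ → ∃ w : CompTraj T,
    w.start = (δ.startCfg, ⟨illst 𝕋, M.subst (substOf δ)⟩) ∧ TermInterp A .provider T w

/-- The fundamental theorem for a term that first communicates at time `T'` over a channel of
its context: it suffices to give the steps from the states that the trajectories of the context
have reached by then. -/
theorem Sound.of_left {Γ : FMap (Ty 𝕋)} {x : Var} {A C : Ty 𝕋} {M : Term 𝕋} (hT : T ≤ T')
    (hx : x ∉ Γ) (hp : A.prop T')
    (h : ∀ (b : Label) (Ω : NCfg 𝕋) (δ : Compl T') (σ : Subst), ValueInterp A .client T' Ω →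
      TypedCompl T' Γ δ → σ = (substOf δ).insert x b →
      ∃ w : CompTraj T', TermInterp C .provider T' w ∧ ∀ a,
        Step (Ω.inst b + δ.startCfg + (M.subst σ).named a) .eps T' (w.start.inst a)) :
    Sound T (Γ.insert x A) M C := by
  intro δ hδ
  obtain ⟨b, w, δ, rfl, hδ, hw⟩ := hδ.exists_of_insert hx
  obtain ⟨w', hw', hs⟩ := h b _ _ (substOf (δ.insert x (b, w)))
    (hw.valueInterp_suffix hT hp) (hδ.suffix hT) (by rw [Compl.substOf_insert, δ.substOf_suffix])
  obtain ⟨v, hv, hv'⟩ := exists_provider_of_steps (δ.insert x (b, w))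
    ⟨illst 𝕋, M.subst (substOf (δ.insert x (b, w)))⟩ C hT
    ⟨w', hw', fun a => .single (by
      rw [Compl.startCfg_suffix_insert hδ hx]
      exact hs a)⟩
  exact ⟨v, hv.symm, hv'⟩

/-- The fundamental theorem for a term that provides its communication: it suffices to give the
value at each time of a possible exchange. -/
theorem Sound.of_right {Γ : FMap (Ty 𝕋)} {M : Term 𝕋} {A : Ty 𝕋}
    (hT : ∀ t, A.prop t → T ≤ t)
    (h : ∀ t, A.prop t → ∀ δ : Compl t, TypedCompl t Γ δ →
      ValueInterp A .provider t (δ.startCfg, ⟨illst 𝕋, M.subst (substOf δ)⟩)) :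
    Sound T Γ M A := by
  intro δ hδ
  obtain ⟨w, hw, hw'⟩ := exists_provider_of_valueInterp δ ⟨illst 𝕋, M.subst (substOf δ)⟩ A
    fun t ht => ⟨hT t ht, by
      rw [← δ.substOf_suffix (hT t ht)]
      exact h t ht _ (hδ.suffix _)⟩
  exact ⟨w, hw.symm, hw'⟩

theorem Sound.fwd {x : Var} {A A' : Ty 𝕋}
    (hA : ∀ w : CompTraj T, TermInterp A .client T w → TermInterp A' .provider T w) :
    Sound T (Finmap.singleton x A) (.fwd T (.var x)) A' := by
  intro δ hδ
  have hx : x ∉ (∅ : FMap (Ty 𝕋)) := Finmap.notMem_empty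
  have hδ' : TypedCompl T ((∅ : FMap (Ty 𝕋)).insert x A) δ := hδ
  obtain ⟨b, w, δ, rfl, hδ₀, hw⟩ := hδ'.exists_of_insert hx
  have hδ₀' : δ = ∅ := Finmap.ext_lookup fun y => by
    rw [Finmap.lookup_empty, Finmap.lookup_eq_none, hδ₀.mem_iff]
    exact Finmap.notMem_empty
  have hsym : (substOf (δ.insert x (b, w))).sym (.var x) = .chan b := by
    rw [Compl.substOf_insert, Subst.sym_insert]
  obtain ⟨v, hv, hv'⟩ := exists_provider_of_steps (δ.insert x (b, w))
    ⟨illst 𝕋, (Term.fwd T (.var x)).subst (substOf (δ.insert x (b, w)))⟩ A' le_rfl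
    ⟨w.suffix le_rfl, hA _ (hw.suffix le_rfl), fun a => by
      have hnil : (δ.suffix (le_refl T)).startCfg = 0 := by rw [hδ₀']; rfl
      rw [Compl.startCfg_suffix_insert hδ₀ hx, hnil, add_zero, Term.subst, hsym]
      generalize (w.suffix (le_refl T)).start = Ω
      have s₁ : Step ((Term.fwd T (.chan b)).named a) .eps T {Atomic.fwd a b} :=
        .obj (S := illst 𝕋) (TermStep.fwd T a b)
      refine .tail (.single (s₁.frame (Ω₀ := Ω.inst b) |>.congr (add_comm _ _) rfl))
        ((Step.fwd (a := b) (b := a) (P := Ω.2) |>.frame (Ω₀ := Ω.1)).congr ?_ ?_)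
      · simp only [NCfg.inst, Multiset.insert_eq_cons, ← Multiset.singleton_add]
        abel
      · exact add_comm _ _⟩
  exact ⟨v, hv.symm, hv'⟩

theorem HasType.sound {n : ℕ} {F : PropCtx 𝕋 n} {Γ : Ctx 𝕋 n} {M : Open 𝕋 n (Term 𝕋)}
    {T : Open 𝕋 n 𝕋} {A : Open 𝕋 n (Ty 𝕋)} (hM : HasType F Γ M T A) :
    ∀ g : TimeEnv 𝕋 n, F.Holds g → Sound (T g) (Γ.inst g) (M g) (A g) := by
  have hins : ∀ {σ τ : Subst} {m : ℕ} {Δ : Ctx 𝕋 m} {x : Var} {B : Open 𝕋 m (Ty 𝕋)} {b : Label},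
      (∀ y ∈ Δ, σ.lookup y = τ.lookup y) →
      ∀ y ∈ Δ.insert x B, (σ.insert x b).lookup y = (τ.insert x b).lookup y := by
    intro σ τ m Δ x B b h y hy
    simp only [FMap.lookup_insert_ite]
    split_ifs with hyx
    · rfl
    · exact h y ((Finmap.mem_insert.1 hy).resolve_left hyx)
  have hsplit : ∀ {m : ℕ} {Δ : Ctx 𝕋 m} {g : TimeEnv 𝕋 m} {σ τ : Subst},
      (∀ y ∈ Δ.inst g, σ.lookup y = τ.lookup y) → ∀ y ∈ Δ, σ.lookup y = τ.lookup y :=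
    fun h y hy => h y ((Ctx.mem_inst _ _ _).2 hy)
  have hdisj : ∀ {m : ℕ} {Γ₁ Γ₂ : Ctx 𝕋 m} (g : TimeEnv 𝕋 m), Γ₁.Disjoint Γ₂ →
      (Γ₁.inst g).Disjoint (Γ₂.inst g) :=
    fun g hd x h₁ h₂ => hd x ((Ctx.mem_inst _ _ _).1 h₁) ((Ctx.mem_inst _ _ _).1 h₂)
  have hnot : ∀ {m : ℕ} {Δ : Ctx 𝕋 m} {x : Var} (g : TimeEnv 𝕋 m), x ∉ Δ → x ∉ Δ.inst g :=
    fun g hx h => hx ((Ctx.mem_inst _ _ _).1 h)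
  induction hM with
  | @cut _ F Γ₁ Γ₂ M₁ M₂ T A A' C x hM₁ hM₂ hA hd hx ih₁ ih₂ =>
    intro g hg
    rw [Ctx.inst_union]
    intro δ hδ
    obtain ⟨δ₁, δ₂, hδ₁, hδ₂, hc, hs₁, hs₂⟩ := (hδ.suffix le_rfl).exists_of_union (hdisj g hd)
    rw [δ.substOf_suffix] at hs₁ hs₂
    obtain ⟨w₁, hw₁, hw₁'⟩ := ih₁ g hg δ₁ hδ₁
    have h₂ := ih₂ g hg
    rw [Ctx.inst_insert] at h₂
    -- Any name will do for the new channel, for configurations impose no freshness.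
    obtain ⟨w₂, hw₂, hw₂'⟩ := h₂ _ (hδ₂.insert (hA.sound g hg _ hw₁') 0)
    have e₁ := hM₁.subst_congr g _ _ (hsplit hs₁)
    have e₂ := hM₂.subst_congr g _ _ (hins (b := 0) (hsplit hs₂))
    obtain ⟨v, hv, hv'⟩ := exists_provider_of_steps δ
      ⟨illst 𝕋, (Term.cut (T g) x (A' g) (M₁ g) (M₂ g)).subst (substOf δ)⟩ (C g) le_rfl
      ⟨w₂, hw₂', fun a => .single (by
        have s := (TermStep.cut (T g) x (A' g) ((M₁ g).subst (substOf δ))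
          ((M₂ g).subst ((substOf δ).erase x)) a 0).step_pair
        rw [Term.subst₁_subst_erase, e₁, e₂] at s
        refine (s.frame (Ω₀ := δ₁.startCfg + δ₂.startCfg)).congr ?_ ?_
        · rw [hc, add_comm, Term.subst, e₁]
          rfl
        · rw [hw₂, Compl.startCfg_insert (fun h => hnot g hx ((hδ₂.mem_iff x).1 h)), hw₁,
            Compl.substOf_insert]
          simp only [NCfg.inst, Term.named]
          abel)⟩
    exact ⟨v, hv.symm, hv'⟩
  | @fwd _ F T A A' x hA =>
    intro g hg
    have : Ctx.inst (Finmap.singleton x A) g = Finmap.singleton x (A g) :=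
      FMap.mapVal_singleton _ _ _
    rw [this]
    exact Sound.fwd (hA.sound g hg)
  | @oneR _ F T p hT =>
    intro g hg
    refine Sound.of_right (fun t ht => hT _ (hg.ext ht)) fun t ht δ hδ => ?_
    refine valueInterp_one.2 fun a => ?_
    have hδ₀ : δ = ∅ := Finmap.ext_lookup fun y => by
      rw [Finmap.lookup_empty, Finmap.lookup_eq_none, hδ.mem_iff]
      exact hnot g Finmap.notMem_empty
    have hnil : δ.startCfg = 0 := by rw [hδ₀]; rfl
    exact (Step.obj (S := illst 𝕋) (TermStep.oneR (p.bind g) a t ht)).congr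
      (by rw [NCfg.inst, hnil, zero_add]; rfl) rfl
  | @oneL _ F Γ M T T' C p x hM hT hp hx ih =>
    intro g hg
    rw [Ctx.inst_insert]
    refine Sound.of_left (hT g hg) (hnot g hx) (hp g hg) fun b Ω δ σ hΩ hδ hσ => ?_
    obtain ⟨w, hw, hw'⟩ := ih g hg δ hδ
    refine ⟨w, hw', fun a => ?_⟩
    have s₁ := valueInterp_one.1 hΩ b
    have s₂ := (TermStep.oneL (T' g) ((M g).subst (σ.erase x)) a b).step_singleton
    have e : (M g).subst (σ.erase x) = (M g).subst (substOf δ) :=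
      hM.subst_congr g _ _ fun y hy => by
        have hyx : y ≠ x := fun h => hx (h ▸ hy)
        rw [FMap.lookup_erase_ite, if_neg hyx, hσ, FMap.lookup_insert_ite, if_neg hyx]
    rw [e] at s₂
    refine ((s₁.comm s₂).frame (Ω₀ := δ.startCfg)).congr ?_ ?_
    · rw [Term.subst, Subst.remove, e, hσ, Subst.sym_insert]
      abel
    · rw [hw, zero_add, add_comm]
      rfl
  | @lolliR _ F Γ M T A₁ A₂ p x hM hT hx ih =>
    intro g hg
    refine Sound.of_right (fun t ht => hT _ (hg.ext ht)) fun t ht δ hδ => ?_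
    refine valueInterp_lolli.2 fun a w₁ hw₁ c => ?_
    have h : Sound t ((Γ.inst g).insert x (A₁.bind g t)) (M.bind g t) (A₂.bind g t) := by
      have h := ih _ (hg.ext ht)
      rwa [Ctx.inst_insert, Ctx.inst_wk] at h
    obtain ⟨w, hw, hw'⟩ := h _ (hδ.insert hw₁ c)
    refine ⟨(δ.startCfg, ⟨illst 𝕋, (M.bind g t).subst ((substOf δ).insert x c)⟩), w, hw', ?_, ?_⟩
    · have s := (TermStep.lolliR (p.bind g) x
        (fun t => (M.bind g t).subst ((substOf δ).erase x)) a c t ht).step_singleton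
      rw [Term.subst₁_subst_erase] at s
      exact (s.frame (Ω₀ := δ.startCfg)).congr (add_comm _ _) (add_comm _ _)
    · rw [hw, Compl.startCfg_insert (fun h => hnot g hx ((hδ.mem_iff x).1 h)),
        Compl.substOf_insert, add_comm]
      rfl
  | @lolliL _ F Γ₁ Γ₂ M₁ M₂ T T' A₁ A₂ C p x hM₁ hM₂ hT hp hd hx₁ hx₂ ih₁ ih₂ =>
    intro g hg
    rw [Ctx.inst_insert, Ctx.inst_union]
    have hx : x ∉ Γ₁.inst g ∪ Γ₂.inst g := fun h =>
      (Finmap.mem_union.1 h).elim (hnot g hx₁) (hnot g hx₂)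
    refine Sound.of_left (hT g hg) hx (hp g hg) fun b Ω δ σ hΩ hδ hσ => ?_
    obtain ⟨δ₁, δ₂, hδ₁, hδ₂, hc, hs₁, hs₂⟩ := hδ.exists_of_union (hdisj g hd)
    obtain ⟨w₁, hw₁, hw₁'⟩ := ih₁ g hg δ₁ hδ₁
    obtain ⟨Ω₂, w₂, hw₂, s₁, hs⟩ := valueInterp_lolli.1 hΩ b w₁ hw₁' 0
    have h₂ := ih₂ g hg
    rw [Ctx.inst_insert] at h₂
    obtain ⟨w, hw, hw'⟩ := h₂ _ (hδ₂.insert hw₂ b)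
    refine ⟨w, hw', fun a => ?_⟩
    have s₂ := (TermStep.lolliL (T' g) ((M₁ g).subst σ) ((M₂ g).subst σ) a b 0).step_pair
    have e₁ : (M₁ g).subst σ = (M₁ g).subst (substOf δ₁) :=
      hM₁.subst_congr g _ _ fun y hy => by
        rw [hσ, FMap.lookup_insert_ite, if_neg fun h : y = x => hx₁ (h ▸ hy),
          hsplit hs₁ y hy]
    have e₂ : (M₂ g).subst σ = (M₂ g).subst ((substOf δ₂).insert x b) :=
      hM₂.subst_congr g _ _ (hσ ▸ hins (hsplit hs₂))
    rw [e₁, e₂] at s₂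
    refine ((s₂.comm s₁).frame (Ω₀ := δ.startCfg)).congr ?_ ?_
    · rw [Term.subst, e₁, e₂, hσ, Subst.sym_insert]
      abel
    · rw [hw, hc, Compl.startCfg_insert (fun h => hnot g hx₂ ((hδ₂.mem_iff x).1 h)),
        Compl.substOf_insert, hs, hw₁]
      simp only [Term.named, NCfg.inst, NCfg.join]
      abel
  | @tensorR _ F Γ₁ Γ₂ M₁ M₂ T A₁ A₂ p hM₁ hM₂ hT hd ih₁ ih₂ =>
    intro g hg
    rw [Ctx.inst_union]
    refine Sound.of_right (fun t ht => hT _ (hg.ext ht)) fun t ht δ hδ => ?_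
    refine valueInterp_tensor.2 fun a => ?_
    obtain ⟨δ₁, δ₂, hδ₁, hδ₂, hc, hs₁, hs₂⟩ := hδ.exists_of_union (hdisj g hd)
    have h₁ : Sound t (Γ₁.inst g) (M₁.bind g t) (A₁.bind g t) := by
      have h := ih₁ _ (hg.ext ht)
      rwa [Ctx.inst_wk] at h
    have h₂ : Sound t (Γ₂.inst g) (M₂.bind g t) (A₂.bind g t) := by
      have h := ih₂ _ (hg.ext ht)
      rwa [Ctx.inst_wk] at h
    obtain ⟨w₁, hw₁, hw₁'⟩ := h₁ δ₁ hδ₁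
    obtain ⟨w₂, hw₂, hw₂'⟩ := h₂ δ₂ hδ₂
    refine ⟨0, w₁, w₂, hw₁', hw₂', ?_⟩
    have s := (TermStep.tensorR (p.bind g) (fun t => (M₁.bind g t).subst (substOf δ))
      (fun t => (M₂.bind g t).subst (substOf δ)) a 0 t ht).step_pair
    refine (s.frame (Ω₀ := δ.startCfg)).congr (add_comm _ _) ?_
    have e₁ := hM₁.subst_congr (g.ext t) (substOf δ) (substOf δ₁)
      fun y hy => hsplit hs₁ y ((FMap.mem_mapVal _ _ _).1 hy)
    have e₂ := hM₂.subst_congr (g.ext t) (substOf δ) (substOf δ₂)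
      fun y hy => hsplit hs₂ y ((FMap.mem_mapVal _ _ _).1 hy)
    simp only [hw₁, hw₂, hc, NCfg.inst, Term.named, Open.bind, e₁, e₂]
    abel
  | @tensorL _ F Γ M T T' A₁ A₂ C p x y hM hT hp hx hy hxy ih =>
    intro g hg
    rw [Ctx.inst_insert]
    refine Sound.of_left (hT g hg) (hnot g hx) (hp g hg) fun b Ω δ σ hΩ hδ hσ => ?_
    obtain ⟨c, w₁, w₂, hw₁, hw₂, s₁⟩ := valueInterp_tensor.1 hΩ b
    have h := ih g hg
    rw [Ctx.inst_insert, Ctx.inst_insert] at h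
    obtain ⟨w, hw, hw'⟩ := h _ ((hδ.insert hw₂ b).insert hw₁ c)
    refine ⟨w, hw', fun a => ?_⟩
    have s₂ := (TermStep.tensorL (T' g) y ((M g).subst (σ.erase y)) a b c).step_singleton
    rw [Term.subst₁_subst_erase] at s₂
    refine ((s₁.comm s₂).frame (Ω₀ := δ.startCfg)).congr ?_ ?_
    · rw [Term.subst, hσ, Subst.sym_insert, ← hσ]; abel
    · have hx' : x ∉ δ := fun h => hnot g hx ((hδ.mem_iff x).1 h)
      have hy' : y ∉ δ.insert x (b, w₂) := fun h => (Finmap.mem_insert.1 h).elim hxy.symm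
        fun h => hnot g hy ((hδ.mem_iff y).1 h)
      rw [hw, Compl.startCfg_insert hy', Compl.startCfg_insert hx', Compl.substOf_insert,
        Compl.substOf_insert, hσ]
      simp only [Term.named, NCfg.inst]
      abel
  | @withR _ F Γ M₁ M₂ T A₁ A₂ p hM₁ hM₂ hT ih₁ ih₂ =>
    intro g hg
    refine Sound.of_right (fun t ht => hT _ (hg.ext ht)) fun t ht δ hδ => ?_
    refine valueInterp_with.2 fun i a => ?_
    have h₁ := ih₁ _ (hg.ext ht)
    have h₂ := ih₂ _ (hg.ext ht)
    rw [Ctx.inst_wk] at h₁ h₂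
    have s := (TermStep.withR (p.bind g) (fun t => (M₁.bind g t).subst (substOf δ))
      (fun t => (M₂.bind g t).subst (substOf δ)) a i t ht).step_singleton
    have s' := (s.frame (Ω₀ := δ.startCfg)).congr (add_comm _ _) (add_comm _ _)
    cases i with
    | false =>
      obtain ⟨w, hw, hw'⟩ := h₁ δ hδ
      exact ⟨w, hw', hw ▸ s'⟩
    | true =>
      obtain ⟨w, hw, hw'⟩ := h₂ δ hδ
      exact ⟨w, hw', hw ▸ s'⟩
  | @withL _ F Γ M T T' A₁ A₂ C p x i hM hT hp hx ih =>
    intro g hg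
    rw [Ctx.inst_insert]
    refine Sound.of_left (hT g hg) (hnot g hx) (hp g hg) fun b Ω δ σ hΩ hδ hσ => ?_
    obtain ⟨w₁, hw₁, s₁⟩ := valueInterp_with.1 hΩ i b
    have h := ih g hg
    rw [Ctx.inst_insert] at h
    have hw₁' : TermInterp ((sel i A₁ A₂).at T' g) .client (T' g) w₁ := by
      cases i <;> exact hw₁
    obtain ⟨w, hw, hw'⟩ := h _ (hδ.insert hw₁' b)
    refine ⟨w, hw', fun a => ?_⟩
    have s₂ := (TermStep.withL (T' g) i ((M g).subst σ) a b).step_singleton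
    refine ((s₂.comm s₁).frame (Ω₀ := δ.startCfg)).congr ?_ ?_
    · rw [Term.subst, hσ, Subst.sym_insert, ← hσ]; abel
    · rw [hw, Compl.startCfg_insert (fun h => hnot g hx ((hδ.mem_iff x).1 h)),
        Compl.substOf_insert, hσ]
      simp only [Term.named, NCfg.inst]
      abel
  | @plusR _ F Γ M T A₁ A₂ p i hM hT ih =>
    intro g hg
    refine Sound.of_right (fun t ht => hT _ (hg.ext ht)) fun t ht δ hδ => ?_
    refine valueInterp_plus.2 ⟨i, fun a => ?_⟩
    have h := ih _ (hg.ext ht)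
    rw [Ctx.inst_wk] at h
    obtain ⟨w, hw, hw'⟩ := h δ hδ
    refine ⟨w, by cases i <;> exact hw', ?_⟩
    have s := (TermStep.plusR (p.bind g) i (fun t => (M.bind g t).subst (substOf δ))
      a t ht).step_singleton
    rw [hw]
    exact (s.frame (Ω₀ := δ.startCfg)).congr (add_comm _ _) (add_comm _ _)
  | @plusL _ F Γ M₁ M₂ T T' A₁ A₂ C p x hM₁ hM₂ hT hp hx ih₁ ih₂ =>
    intro g hg
    rw [Ctx.inst_insert]
    refine Sound.of_left (hT g hg) (hnot g hx) (hp g hg) fun b Ω δ σ hΩ hδ hσ => ?_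
    obtain ⟨i, hi⟩ := valueInterp_plus.1 hΩ
    obtain ⟨w₁, hw₁, s₁⟩ := hi b
    have h : Sound (T' g) ((Γ.inst g).insert x (sel i (A₁.bind g) (A₂.bind g) (T' g)))
        (sel i (M₁ g) (M₂ g)) (C g) := by
      have h₁ := ih₁ g hg
      have h₂ := ih₂ g hg
      rw [Ctx.inst_insert] at h₁ h₂
      cases i
      exacts [h₁, h₂]
    obtain ⟨w, hw, hw'⟩ := h _ (hδ.insert hw₁ b)
    refine ⟨w, hw', fun a => ?_⟩
    have s₂ := (TermStep.plusL (T' g) ((M₁ g).subst σ) ((M₂ g).subst σ) a b i).step_singleton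
    refine ((s₁.comm s₂).frame (Ω₀ := δ.startCfg)).congr ?_ ?_
    · rw [Term.subst, hσ, Subst.sym_insert, ← hσ]; abel
    · have hsel : sel i ((M₁ g).subst σ) ((M₂ g).subst σ) = (sel i (M₁ g) (M₂ g)).subst σ := by
        cases i <;> rfl
      rw [hw, Compl.startCfg_insert (fun h => hnot g hx ((hδ.mem_iff x).1 h)),
        Compl.substOf_insert, hsel, hσ]
      simp only [Term.named, NCfg.inst]
      abel

end Fundamental

end TimedILLST

theorem theorem1 {𝕋 : Type u} [LinearOrder 𝕋] {n : ℕ} {F : TimedILLST.PropCtx 𝕋 n}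
    {Γ : TimedILLST.Ctx 𝕋 n} {M : TimedILLST.Open 𝕋 n (TimedILLST.Term 𝕋)}
    {T : TimedILLST.Open 𝕋 n 𝕋} {A : TimedILLST.Open 𝕋 n (TimedILLST.Ty 𝕋)}
    (hM : TimedILLST.HasType F Γ M T A)
    (g : TimedILLST.TimeEnv 𝕋 n) (hg : F.Holds g)
    (δ : TimedILLST.Compl (T g)) (hδ : TimedILLST.TypedCompl (T g) (Γ.inst g) δ) :
    ∃ w : TimedILLST.CompTraj (T g),
      TimedILLST.applyCompl δ ⟨TimedILLST.illst 𝕋, (M g).subst (TimedILLST.substOf δ)⟩ = w.start ∧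
      TimedILLST.TermInterp (A g) .provider (T g) w := by
  obtain ⟨w, hw, hw'⟩ := hM.sound g hg δ hδ
  exact ⟨w, hw.symm, hw'⟩
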